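/- Fix $n\in\mathbb{N}$. A $\rho$-name of a real number $x$ is a sequence of rationals $r_k=(-1)^{a(k)}\frac{b(k)}{c(k)+1}$, $k\in\mathbb N$ (given by functions $a,b,c:\mathbb{N}\to\mathbb{N}$), with $|r_k-x|\le 2^{-k}$ for all $k$; a $\rho$-name of a point of $\mathbb{R}^n$, or of a matrix $A\in\mathbb{R}^{n\times n}$, consists of $\rho$-names of all its coordinates, respectively entries. A name of a closed set $C\subseteq\mathbb{R}^n$ consists of (i) $\rho$-names of the terms of a (possibly finite or empty) sequence of points of $C$ that is dense in $C$, where the list of names may contain empty entries, and (ii) a sequence of rational centres $a_m\in\mathbb{Q}^n$ and rational radii $r_m\in\mathbb{Q}$ with $\mathbb{R}^n\setminus C=\bigcup_{m} B(a_m,r_m)$, where $B(a,r)=\{x\in\mathbb{R}^n:|x-a|<r\}$ for the Euclidean norm. All names are coded as elements of $\mathbb{N}^{\mathbb{N}}$. A map is computable if there is a single Type-2 machine (equivalently, oracle machine) that transforms every name of every argument into some name of its value. Let $\mathfrak{A}_H$ be the set of real $n\times n$ matrices all of whose complex eigenvalues have nonzero real part. For $A\in\mathfrak{A}_H$ let the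 stable subspace $\mathbb{E}^s_A\subseteq\mathbb{R}^n$ (respectively the unstable subspace $\mathbb{E}^u_A\subseteq\mathbb{R}^n$) be the real span of the real and imaginary parts of all generalized eigenvectors in $\mathbb{C}^n$ of $A$ for eigenvalues $\lambda$ with $\operatorname{Re}\lambda<0$ (respectively $\operatorname{Re}\lambda>0$). **Theorem.** The maps $A\mapsto\mathbb{E}^s_A$ and $A\mapsto\mathbb{E}^u_A$ from $\mathfrak{A}_H$, represented by entrywise $\rho$-names, to the closed subsets of $\mathbb{R}^n$ are computable. -/

import Mathlib

/-- Programs with access to an oracle.  The constructors are those of Mathlib's `Nat.RecursiveIn`;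
having them as data allows one finite program to be run uniformly on every oracle. -/
inductive OracleProgram : Type
  | zero : OracleProgram
  | succ : OracleProgram
  | left : OracleProgram
  | right : OracleProgram
  | query : OracleProgram
  | pair : OracleProgram → OracleProgram → OracleProgram
  | comp : OracleProgram → OracleProgram → OracleProgram
  | prec : OracleProgram → OracleProgram → OracleProgram
  | rfind : OracleProgram → OracleProgram

/-- The partial function computed by a program with the infinite sequence `p` as oracle.

This is a Type-2 machine: `p` is the infinite read-only input, the program can inspect the entry
`p m` for any `m`, and `m ↦ run p c m`, produced for `m = 0, 1, 2, …` in turn, is the infinite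
output, each entry of which is determined after finitely many steps. -/
def OracleProgram.run (p : ℕ → ℕ) : OracleProgram → ℕ →. ℕ
  | .zero => fun _ => Part.some 0
  | .succ => fun m => Part.some (m + 1)
  | .left => fun m => Part.some m.unpair.1
  | .right => fun m => Part.some m.unpair.2
  | .query => fun m => Part.some (p m)
  | .pair c d => fun m => Nat.pair <$> c.run p m <*> d.run p m
  | .comp c d => fun m => d.run p m >>= c.run p
  | .prec c d => fun m =>
      m.unpair.2.rec (c.run p m.unpair.1) fun y IH => do
        let i ← IH
        d.run p (Nat.pair m.unpair.1 (Nat.pair y i))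
  | .rfind c => fun m => Nat.rfind fun k => (fun v => v = 0) <$> c.run p (Nat.pair m k)

/-- For a fixed oracle, programs compute exactly the functions that are recursive in the oracle
in Mathlib's sense. -/
theorem OracleProgram.exists_run_eq_iff (p : ℕ → ℕ) (f : ℕ →. ℕ) :
    (∃ c : OracleProgram, c.run p = f) ↔ Nat.RecursiveIn {(p : ℕ →. ℕ)} f := by
  constructor
  · rintro ⟨c, rfl⟩
    induction c with
    | zero => exact .zero
    | succ => exact .succ
    | left => exact .left
    | right => exact .right
    | query => exact .oracle _ rfl
    | pair c d hc hd => exact .pair hc hd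
    | comp c d hc hd => exact .comp hc hd
    | prec c d hc hd => exact .prec hc hd
    | rfind c hc => exact .rfind hc
  · intro h
    induction h with
    | zero => exact ⟨.zero, rfl⟩
    | succ => exact ⟨.succ, rfl⟩
    | left => exact ⟨.left, rfl⟩
    | right => exact ⟨.right, rfl⟩
    | oracle g hg => exact ⟨.query, (Set.mem_singleton_iff.mp hg).symm⟩
    | pair _ _ hf hg =>
      obtain ⟨c, rfl⟩ := hf
      obtain ⟨d, rfl⟩ := hg
      exact ⟨.pair c d, rfl⟩
    | comp _ _ hf hg =>
      obtain ⟨c, rfl⟩ := hf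
      obtain ⟨d, rfl⟩ := hg
      exact ⟨.comp c d, rfl⟩
    | prec _ _ hf hg =>
      obtain ⟨c, rfl⟩ := hf
      obtain ⟨d, rfl⟩ := hg
      exact ⟨.prec c d, rfl⟩
    | rfind _ hf =>
      obtain ⟨c, rfl⟩ := hf
      exact ⟨.rfind c, rfl⟩

/-- A map `f : X → Y` is computable with respect to naming systems on `X` and `Y`
(`nameX p x` means that `p` is a name of `x`) if one machine transforms every name of every `x`
into some name of `f x`. -/
def IsComputableMap {X Y : Type*} (nameX : (ℕ → ℕ) → X → Prop) (nameY : (ℕ → ℕ) → Y → Prop)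
    (f : X → Y) : Prop :=
  ∃ c : OracleProgram, ∀ (x : X) (p : ℕ → ℕ), nameX p x →
    ∃ q : ℕ → ℕ, (∀ m, c.run p m = Part.some (q m)) ∧ nameY q (f x)

/-- The rational number `(-1)^a * b / (c + 1)` with code `m = ⟨a, ⟨b, c⟩⟩`. -/
def ratOfCode (m : ℕ) : ℚ :=
  (-1) ^ m.unpair.1 * (m.unpair.2.unpair.1 : ℚ) / ((m.unpair.2.unpair.2 : ℚ) + 1)

/-- `p` is a `ρ`-name of the real number `x`: the `k`-th coded rational is within `2 ^ (-k)`. -/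
def IsRealName (p : ℕ → ℕ) (x : ℝ) : Prop :=
  ∀ k : ℕ, |(ratOfCode (p k) : ℝ) - x| ≤ 1 / 2 ^ k

/-- `p` is a `ρ`-name of the point `x`: the sequence `p ⟨j, ·⟩` is a `ρ`-name of the
coordinate `x j`. -/
def IsPointName {n : ℕ} (p : ℕ → ℕ) (x : EuclideanSpace ℝ (Fin n)) : Prop :=
  ∀ j : Fin n, IsRealName (fun k => p (Nat.pair j k)) (x j)

/-- `p` is an entrywise `ρ`-name of the matrix `A`: the sequence `p ⟨i, ⟨j, ·⟩⟩` is a `ρ`-name of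
the entry `A i j`. -/
def IsMatrixName {n : ℕ} (p : ℕ → ℕ) (A : Matrix (Fin n) (Fin n) ℝ) : Prop :=
  ∀ i j : Fin n, IsRealName (fun k => p (Nat.pair i (Nat.pair j k))) (A i j)

/-- `p` is a name of the open set `U`: it lists rational balls whose union is `U`.  The `m`-th ball
has the radius coded by `p ⟨m, 0⟩` and the centre with `j`-th coordinate coded by `p ⟨m, j + 1⟩`
(a ball whose radius is not positive is empty). -/
def IsOpenName {n : ℕ} (p : ℕ → ℕ) (U : Set (EuclideanSpace ℝ (Fin n))) : Prop :=
  U = ⋃ m : ℕ, Metric.ball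
    (WithLp.toLp 2 fun j : Fin n => (ratOfCode (p (Nat.pair m ((j : ℕ) + 1))) : ℝ))
    (ratOfCode (p (Nat.pair m 0)) : ℝ)

/-- `p` lists a dense sequence of points of the closed set `C`.  The `l`-th point is given by the
`ρ`-name `p ⟨l, · + 1⟩`; the sequence may skip the index `l`, by `p ⟨l, 0⟩ = 0`, so that
the empty set has a name too. -/
def IsDenseName {n : ℕ} (p : ℕ → ℕ) (C : Set (EuclideanSpace ℝ (Fin n))) : Prop :=
  ∃ b : ℕ → EuclideanSpace ℝ (Fin n),
    (∀ l, p (Nat.pair l 0) ≠ 0 → IsPointName (fun k => p (Nat.pair l (k + 1))) (b l)) ∧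
    closure {x | ∃ l, p (Nat.pair l 0) ≠ 0 ∧ b l = x} = C

/-- `p` is a name of the closed set `C`: its even entries list a dense sequence in `C` and its odd
entries list rational balls that exhaust the complement of `C`. -/
def IsClosedName {n : ℕ} (p : ℕ → ℕ)
    (C : TopologicalSpace.Closeds (EuclideanSpace ℝ (Fin n))) : Prop :=
  IsDenseName (fun m => p (2 * m)) (C : Set (EuclideanSpace ℝ (Fin n))) ∧
    IsOpenName (fun m => p (2 * m + 1)) (C : Set (EuclideanSpace ℝ (Fin n)))ᶜ

/-- The endomorphism of `ℂⁿ` given by a real matrix. -/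
noncomputable def complexEnd {n : ℕ} (A : Matrix (Fin n) (Fin n) ℝ) :
    Module.End ℂ (Fin n → ℂ) :=
  Matrix.toLin' (A.map (fun a : ℝ => (a : ℂ)))

/-- All complex eigenvalues of `A` have nonzero real part. -/
def IsHyperbolicMatrix {n : ℕ} (A : Matrix (Fin n) (Fin n) ℝ) : Prop :=
  ∀ z : ℂ, (complexEnd A).HasEigenvalue z → z.re ≠ 0

/-- The subspace of `ℝⁿ` spanned by the real and imaginary parts of the complex generalized
eigenvectors of `A` for the eigenvalues in `S`. -/
noncomputable def spectralSubspace {n : ℕ} (A : Matrix (Fin n) (Fin n) ℝ) (S : Set ℂ) :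
    Submodule ℝ (EuclideanSpace ℝ (Fin n)) :=
  Submodule.span ℝ {v | ∃ z ∈ S, ∃ w ∈ (complexEnd A).maxGenEigenspace z,
    v = WithLp.toLp 2 (fun i => (w i).re) ∨ v = WithLp.toLp 2 (fun i => (w i).im)}

/-- The stable subspace of `A`, as a closed subset of `ℝⁿ`. -/
noncomputable def stableSubspace {n : ℕ} (A : Matrix (Fin n) (Fin n) ℝ) :
    TopologicalSpace.Closeds (EuclideanSpace ℝ (Fin n)) :=
  ⟨(spectralSubspace A {z | z.re < 0} : Set (EuclideanSpace ℝ (Fin n))),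
    Submodule.closed_of_finiteDimensional _⟩

/-- The unstable subspace of `A`, as a closed subset of `ℝⁿ`. -/
noncomputable def unstableSubspace {n : ℕ} (A : Matrix (Fin n) (Fin n) ℝ) :
    TopologicalSpace.Closeds (EuclideanSpace ℝ (Fin n)) :=
  ⟨(spectralSubspace A {z | 0 < z.re} : Set (EuclideanSpace ℝ (Fin n))),
    Submodule.closed_of_finiteDimensional _⟩

/-! Let `P` be the projection onto the stable subspace along the unstable one. It is a polynomial of
degree less than `n` in `A`, though its coefficients cannot be read off continuously from
eigenvalues. Since the stable subspace is the range of `P` and the kernel of `1 - P`, approximations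
of `P` with known error suffice. They are found by unbounded search for certificates.

A certificate consists of a polynomial `q`, numbers `b i > 0` and `d i`, and an error bound `δ <
1/4`. Put `E = q(A)`, `f = rootPoly b d`, `g = rootPoly (-b) d` and `β = ∏ b i ^ 2`. The roots of
`f` lie in the left half plane, those of `g` in the right one, and `|f| ≥ β`, `|g| ≥ β` on the
respective opposite closed half planes. The certificate asserts that `E f(A)` and `(1 - E) g(A)`
have norm less than `β/4` and that `E * E - E` is small. A Newton iteration then gives an exact
idempotent `e` within `δ` of `E` (`exists_idempotent_near`). If `e ≠ P`, then `A` has an eigenvector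
on which `e` and `P` act by different scalars; there `E f(A)` or `(1 - E) g(A)` has an eigenvalue of
modulus at least `3β/4`, which is impossible. Hence `‖E - P‖ < δ`
(`SpectralSplitting.sumSq_sub_proj_lt`). The `b i`, `d i` need not be related to the eigenvalues of
`A`.

Conversely, the eigenvalues of `A` give an exact certificate with `E = P` (`exists_certificate`).
All conditions are strict polynomial inequalities, so they survive small perturbations. Each
polynomial carries a polynomial Lipschitz bound, so a decidable test on rational approximations
implies the inequality at the exact data, and succeeds once the precision is high enough.

Images of rational points under `P` give the dense sequence. A ball is listed when the test shows
`(1 - P) x ≠ 0` for all its points `x`. For the unstable subspace, replace `A` by `-A`. -/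

/-! ### Functions computed by one oracle program, uniformly in the oracle -/

namespace OracleProgram

/-- Partial recursive functions are computed by programs that do not use the oracle. -/
theorem exists_run_eq_of_partrec {f : ℕ →. ℕ} (hf : Nat.Partrec f) :
    ∃ c : OracleProgram, ∀ p, c.run p = f := by
  induction hf with
  | zero => exact ⟨.zero, fun _ => rfl⟩
  | succ => exact ⟨.succ, fun _ => rfl⟩
  | left => exact ⟨.left, fun _ => rfl⟩
  | right => exact ⟨.right, fun _ => rfl⟩
  | pair _ _ hf hg =>
    obtain ⟨c, hc⟩ := hf
    obtain ⟨d, hd⟩ := hg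
    exact ⟨.pair c d, fun p => by rw [← hc p, ← hd p]; rfl⟩
  | comp _ _ hf hg =>
    obtain ⟨c, hc⟩ := hf
    obtain ⟨d, hd⟩ := hg
    exact ⟨.comp c d, fun p => by rw [← hc p, ← hd p]; rfl⟩
  | prec _ _ hf hg =>
    obtain ⟨c, hc⟩ := hf
    obtain ⟨d, hd⟩ := hg
    exact ⟨.prec c d, fun p => by rw [← hc p, ← hd p]; rfl⟩
  | rfind _ hf =>
    obtain ⟨c, hc⟩ := hf
    exact ⟨.rfind c, fun p => by rw [← hc p]; rfl⟩

/-- The program obtained by answering each query with the program `e`. -/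
def subst (e : OracleProgram) : OracleProgram → OracleProgram
  | .zero => .zero
  | .succ => .succ
  | .left => .left
  | .right => .right
  | .query => e
  | .pair c d => .pair (subst e c) (subst e d)
  | .comp c d => .comp (subst e c) (subst e d)
  | .prec c d => .prec (subst e c) (subst e d)
  | .rfind c => .rfind (subst e c)

theorem run_subst {e : OracleProgram} {p p' : ℕ → ℕ} (h : ∀ m, e.run p m = Part.some (p' m))
    (c : OracleProgram) : (subst e c).run p = c.run p' := by
  induction c with
  | zero => rfl
  | succ => rfl
  | left => rfl
  | right => rfl
  | query => exact funext h
  | pair c d hc hd => simp only [subst, run, hc, hd]; rfl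
  | comp c d hc hd => simp only [subst, run, hc, hd]; rfl
  | prec c d hc hd => simp only [subst, run, hc, hd]; rfl
  | rfind c hc => simp only [subst, run, hc]; rfl

end OracleProgram

/-- `g` is total and computed, uniformly in the oracle, by one program. -/
def OracleComputable {α β : Type*} [Primcodable α] [Primcodable β] (g : (ℕ → ℕ) → α → β) : Prop :=
  ∃ c : OracleProgram, ∀ p a, c.run p (Encodable.encode a) = Part.some (Encodable.encode (g p a))

section OracleComputable

variable {α β γ δ : Type*} [Primcodable α] [Primcodable β] [Primcodable γ] [Primcodable δ]

theorem Computable.oracleComputable {f : α → β} (hf : Computable f) :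
    OracleComputable fun _ => f := by
  obtain ⟨c, hc⟩ := OracleProgram.exists_run_eq_of_partrec hf
  refine ⟨c, fun p a => ?_⟩
  rw [hc p]
  simp

theorem Primrec.oracleComputable {f : α → β} (hf : Primrec f) : OracleComputable fun _ => f :=
  hf.to_comp.oracleComputable

namespace OracleComputable

theorem of_eq {f g : (ℕ → ℕ) → α → β} (hf : OracleComputable f) (h : ∀ p a, f p a = g p a) :
    OracleComputable g := by
  obtain rfl : f = g := funext fun p => funext fun a => h p a
  exact hf

theorem query : OracleComputable fun p (m : ℕ) => p m := ⟨.query, fun _ _ => rfl⟩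

theorem comp {g : (ℕ → ℕ) → β → γ} {f : (ℕ → ℕ) → α → β} (hg : OracleComputable g)
    (hf : OracleComputable f) : OracleComputable fun p a => g p (f p a) := by
  obtain ⟨c, hc⟩ := hg
  obtain ⟨d, hd⟩ := hf
  refine ⟨.comp c d, fun p a => ?_⟩
  simp only [OracleProgram.run, hd]
  exact (Part.bind_some _ _).trans (hc p _)

theorem pair {f : (ℕ → ℕ) → α → β} {g : (ℕ → ℕ) → α → γ} (hf : OracleComputable f)
    (hg : OracleComputable g) : OracleComputable fun p a => (f p a, g p a) := by
  obtain ⟨c, hc⟩ := hf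
  obtain ⟨d, hd⟩ := hg
  exact ⟨.pair c d, fun p a => by simp [OracleProgram.run, hc, hd, Seq.seq]⟩

theorem comp₂ {h : β → γ → δ} {f : (ℕ → ℕ) → α → β} {g : (ℕ → ℕ) → α → γ} (hh : Primrec₂ h)
    (hf : OracleComputable f) (hg : OracleComputable g) :
    OracleComputable fun p a => h (f p a) (g p a) :=
  (Primrec.oracleComputable (f := fun x : β × γ => h x.1 x.2) hh).comp (hf.pair hg)

theorem comp₁ {h : β → γ} {f : (ℕ → ℕ) → α → β} (hh : Primrec h)
    (hf : OracleComputable f) : OracleComputable fun p a => h (f p a) :=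
  hh.oracleComputable.comp hf

theorem const (b : β) : OracleComputable fun _ (_ : α) => b :=
  (Primrec.const b).oracleComputable

theorem cond {c : (ℕ → ℕ) → α → Bool} {f g : (ℕ → ℕ) → α → β} (hc : OracleComputable c)
    (hf : OracleComputable f) (hg : OracleComputable g) :
    OracleComputable fun p a => bif c p a then f p a else g p a :=
  (Primrec.oracleComputable (f := fun x : Bool × β × β => bif x.1 then x.2.1 else x.2.2)
    (Primrec.cond .fst (.comp .fst .snd) (.comp .snd .snd))).comp (hc.pair (hf.pair hg))

theorem list_ofFn {n : ℕ} {f : Fin n → (ℕ → ℕ) → α → β} (hf : ∀ i, OracleComputable (f i)) :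
    OracleComputable fun p a => List.ofFn fun i => f i p a := by
  induction n with
  | zero => exact (const ([] : List β)).of_eq fun p a => by simp
  | succ n ih =>
    exact (comp₂ Primrec.list_cons (hf 0) (ih fun i => hf i.succ)).of_eq fun p a => by
      simp [List.ofFn_succ]

/-- Unbounded search. -/
theorem exists_run_search {t : (ℕ → ℕ) → ℕ × ℕ → Bool} {g : (ℕ → ℕ) → ℕ × ℕ → ℕ}
    (ht : OracleComputable t) (hg : OracleComputable g) :
    ∃ c : OracleProgram, ∀ p m, (∃ s, t p (m, s) = true) →
      ∃ s, t p (m, s) = true ∧ c.run p m = Part.some (g p (m, s)) := by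
  -- `rfind` looks for a zero, so success of the test is turned into `0`.
  obtain ⟨c, hc⟩ := (comp₁ (h := fun b : Bool => bif b then 0 else 1)
    (Primrec.cond .id (.const 0) (.const 1)) ht : OracleComputable _)
  obtain ⟨d, hd⟩ := hg
  obtain ⟨i, hi⟩ := (Primrec.id.oracleComputable : OracleComputable fun _ (x : ℕ) => id x)
  refine ⟨.comp d (.pair i (.rfind c)), fun p m h => ⟨Nat.find h, Nat.find_spec h, ?_⟩⟩
  have hr : (OracleProgram.rfind c).run p m = Part.some (Nat.find h) := by
    rw [Part.eq_some_iff]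
    have key : ∀ k, c.run p (Nat.pair m k) = Part.some (bif t p (m, k) then 0 else 1) :=
      fun k => by simpa using hc p (m, k)
    refine Nat.mem_rfind.2 ⟨?_, fun {k} hk => ?_⟩
    · simp [key, Nat.find_spec h]
    · have := Nat.find_min h hk
      simp [key, this]
  have hi' := hi p m
  have hd' := hd p (m, Nat.find h)
  simp only [Encodable.encode_nat, id, Encodable.encode_prod_val] at hi' hd'
  simp [OracleProgram.run, hi', Seq.seq] at hr ⊢
  simp only [hr, Part.map_some]
  exact (Part.bind_some _ _).trans hd'

end OracleComputable

end OracleComputable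

/-! ### Rational arithmetic on codes -/

theorem primrec_unpair_fst : Primrec fun m : ℕ => m.unpair.1 := .comp .fst .unpair

theorem primrec_unpair_snd : Primrec fun m : ℕ => m.unpair.2 := .comp .snd .unpair

/-- Numerator of the positive part of the coded rational. -/
def codePos (m : ℕ) : ℕ := bif m.unpair.1.bodd then 0 else m.unpair.2.unpair.1

/-- Numerator of the negative part of the coded rational. -/
def codeNeg (m : ℕ) : ℕ := bif m.unpair.1.bodd then m.unpair.2.unpair.1 else 0

/-- Denominator of the coded rational. -/
def codeDen (m : ℕ) : ℕ := m.unpair.2.unpair.2 + 1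

/-- A code of `(u - w) / d`. -/
def codeOfDiff (u w d : ℕ) : ℕ :=
  bif decide (w ≤ u) then Nat.pair 0 (Nat.pair (u - w) (d - 1))
  else Nat.pair 1 (Nat.pair (w - u) (d - 1))

theorem codeDen_pos (m : ℕ) : 0 < codeDen m := Nat.succ_pos _

theorem ratOfCode_eq (m : ℕ) : ratOfCode m = ((codePos m : ℚ) - codeNeg m) / codeDen m := by
  rcases Bool.eq_false_or_eq_true m.unpair.1.bodd with h | h
  · have ho : Odd m.unpair.1 := Nat.odd_iff.2 (by rw [Nat.mod_two_of_bodd, h]; rfl)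
    simp [ratOfCode, codePos, codeNeg, codeDen, h, ho.neg_one_pow]
  · have he : Even m.unpair.1 := Nat.even_iff.2 (by rw [Nat.mod_two_of_bodd, h]; rfl)
    simp [ratOfCode, codePos, codeNeg, codeDen, h, he.neg_one_pow]

theorem ratOfCode_codeOfDiff (u w : ℕ) {d : ℕ} (hd : 0 < d) :
    ratOfCode (codeOfDiff u w d) = ((u : ℚ) - w) / d := by
  obtain ⟨d, rfl⟩ := Nat.exists_eq_succ_of_ne_zero hd.ne'
  by_cases h : w ≤ u
  · simp [codeOfDiff, h, ratOfCode]
  · simp [codeOfDiff, h, ratOfCode, (not_le.1 h).le]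

theorem primrec_codePos : Primrec codePos :=
  .cond (Primrec.nat_bodd.comp primrec_unpair_fst) (.const 0)
    (primrec_unpair_fst.comp primrec_unpair_snd)

theorem primrec_codeNeg : Primrec codeNeg :=
  .cond (Primrec.nat_bodd.comp primrec_unpair_fst) (primrec_unpair_fst.comp primrec_unpair_snd)
    (.const 0)

theorem primrec_codeDen : Primrec codeDen :=
  Primrec.succ.comp (primrec_unpair_snd.comp primrec_unpair_snd)

theorem primrec_codeOfDiff {α : Type*} [Primcodable α] {u w d : α → ℕ} (hu : Primrec u)
    (hw : Primrec w) (hd : Primrec d) : Primrec fun a => codeOfDiff (u a) (w a) (d a) :=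
  .cond (PrimrecPred.decide (Primrec.nat_le.comp hw hu))
    (Primrec₂.natPair.comp (.const 0) (Primrec₂.natPair.comp (Primrec.nat_sub.comp hu hw)
      (Primrec.nat_sub.comp hd (.const 1))))
    (Primrec₂.natPair.comp (.const 1) (Primrec₂.natPair.comp (Primrec.nat_sub.comp hw hu)
      (Primrec.nat_sub.comp hd (.const 1))))

/-- Addition of coded rationals. -/
def codeAdd (x y : ℕ) : ℕ :=
  codeOfDiff (codePos x * codeDen y + codePos y * codeDen x)
    (codeNeg x * codeDen y + codeNeg y * codeDen x) (codeDen x * codeDen y)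

/-- Multiplication of coded rationals. -/
def codeMul (x y : ℕ) : ℕ :=
  codeOfDiff (codePos x * codePos y + codeNeg x * codeNeg y)
    (codePos x * codeNeg y + codeNeg x * codePos y) (codeDen x * codeDen y)

/-- Negation of coded rationals. -/
def codeOpp (x : ℕ) : ℕ := codeOfDiff (codeNeg x) (codePos x) (codeDen x)

/-- A code of `1 / 2 ^ k`. -/
def codeTwoPow (k : ℕ) : ℕ := codeOfDiff 1 0 (2 ^ k)

theorem ratOfCode_codeAdd (x y : ℕ) : ratOfCode (codeAdd x y) = ratOfCode x + ratOfCode y := by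
  have hx := codeDen_pos x
  have hy := codeDen_pos y
  rw [codeAdd, ratOfCode_codeOfDiff _ _ (by positivity), ratOfCode_eq x, ratOfCode_eq y]
  push_cast
  field_simp
  ring

theorem ratOfCode_codeMul (x y : ℕ) : ratOfCode (codeMul x y) = ratOfCode x * ratOfCode y := by
  have hx := codeDen_pos x
  have hy := codeDen_pos y
  rw [codeMul, ratOfCode_codeOfDiff _ _ (by positivity), ratOfCode_eq x, ratOfCode_eq y]
  push_cast
  field_simp
  ring

theorem ratOfCode_codeOpp (x : ℕ) : ratOfCode (codeOpp x) = -ratOfCode x := by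
  rw [codeOpp, ratOfCode_codeOfDiff _ _ (codeDen_pos x), ratOfCode_eq x]
  ring

theorem ratOfCode_codeTwoPow (k : ℕ) : ratOfCode (codeTwoPow k) = 1 / 2 ^ k := by
  rw [codeTwoPow, ratOfCode_codeOfDiff _ _ (by positivity)]
  simp

theorem ratOfCode_zero : ratOfCode 0 = 0 := by simp [ratOfCode]

theorem ratOfCode_pos_iff (x : ℕ) : 0 < ratOfCode x ↔ codeNeg x < codePos x := by
  have hx : (0 : ℚ) < codeDen x := by exact_mod_cast codeDen_pos x
  rw [ratOfCode_eq, div_pos_iff_of_pos_right hx, sub_pos]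
  exact_mod_cast Iff.rfl

theorem ratOfCode_surjective : Function.Surjective ratOfCode := fun q => by
  refine ⟨codeOfDiff q.num.toNat (-q.num).toNat q.den, ?_⟩
  rw [ratOfCode_codeOfDiff _ _ q.den_pos]
  have h : ((q.num.toNat : ℤ) - ((-q.num).toNat : ℤ)) = q.num := by omega
  have h' : ((q.num.toNat : ℚ) - ((-q.num).toNat : ℚ)) = q.num := by exact_mod_cast h
  rw [h', Rat.num_div_den]

theorem primrec_codeAdd : Primrec₂ codeAdd :=
  have p {f : ℕ → ℕ} (hf : Primrec f) : Primrec fun x : ℕ × ℕ => f x.1 := hf.comp .fst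
  have q {f : ℕ → ℕ} (hf : Primrec f) : Primrec fun x : ℕ × ℕ => f x.2 := hf.comp .snd
  primrec_codeOfDiff
    (Primrec.nat_add.comp (Primrec.nat_mul.comp (p primrec_codePos) (q primrec_codeDen))
      (Primrec.nat_mul.comp (q primrec_codePos) (p primrec_codeDen)))
    (Primrec.nat_add.comp (Primrec.nat_mul.comp (p primrec_codeNeg) (q primrec_codeDen))
      (Primrec.nat_mul.comp (q primrec_codeNeg) (p primrec_codeDen)))
    (Primrec.nat_mul.comp (p primrec_codeDen) (q primrec_codeDen))

theorem primrec_codeMul : Primrec₂ codeMul :=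
  have p {f : ℕ → ℕ} (hf : Primrec f) : Primrec fun x : ℕ × ℕ => f x.1 := hf.comp .fst
  have q {f : ℕ → ℕ} (hf : Primrec f) : Primrec fun x : ℕ × ℕ => f x.2 := hf.comp .snd
  primrec_codeOfDiff
    (Primrec.nat_add.comp (Primrec.nat_mul.comp (p primrec_codePos) (q primrec_codePos))
      (Primrec.nat_mul.comp (p primrec_codeNeg) (q primrec_codeNeg)))
    (Primrec.nat_add.comp (Primrec.nat_mul.comp (p primrec_codePos) (q primrec_codeNeg))
      (Primrec.nat_mul.comp (p primrec_codeNeg) (q primrec_codePos)))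
    (Primrec.nat_mul.comp (p primrec_codeDen) (q primrec_codeDen))

theorem primrec_codeOpp : Primrec codeOpp :=
  primrec_codeOfDiff primrec_codeNeg primrec_codePos primrec_codeDen

theorem primrec_codeTwoPow : Primrec codeTwoPow :=
  primrec_codeOfDiff (.const 1) (.const 0)
    ((Primrec₂.unpaired'.1 Nat.Primrec.pow).comp (.const 2) .id)

/-- The `i`-th entry of the list coded by `l`. -/
def listEntry (i l : ℕ) : ℕ := (Denumerable.ofNat (List ℕ) l).getD i 0

theorem primrec_listEntry : Primrec₂ listEntry :=
  (Primrec.list_getD 0).comp ((Primrec.ofNat (List ℕ)).comp .snd) .fst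

theorem exists_listEntry_eq (N : ℕ) (f : ℕ → ℕ) : ∃ l, ∀ i < N, listEntry i l = f i := by
  refine ⟨Encodable.encode ((List.range N).map f), fun i hi => ?_⟩
  simp [listEntry, List.getD, hi]

namespace OracleComputable

variable {α : Type*} [Primcodable α] {σ : Type*}

/-- Polynomials with rational coefficients can be evaluated on codes. -/
theorem exists_ratOfCode_eq_aeval {u : σ → (ℕ → ℕ) → α → ℕ} (hu : ∀ s, OracleComputable (u s))
    (f : MvPolynomial σ ℚ) : ∃ g : (ℕ → ℕ) → α → ℕ, OracleComputable g ∧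
      ∀ p a, ratOfCode (g p a) = MvPolynomial.eval (fun s => ratOfCode (u s p a)) f := by
  induction f using MvPolynomial.induction_on with
  | C r =>
    obtain ⟨m, rfl⟩ := ratOfCode_surjective r
    exact ⟨fun _ _ => m, const m, by simp⟩
  | add f g hf hg =>
    obtain ⟨F, hF, hF'⟩ := hf
    obtain ⟨G, hG, hG'⟩ := hg
    exact ⟨_, comp₂ primrec_codeAdd hF hG, fun p a => by simp [ratOfCode_codeAdd, hF', hG']⟩
  | mul_X f s hf =>
    obtain ⟨F, hF, hF'⟩ := hf
    exact ⟨_, comp₂ primrec_codeMul hF (hu s), fun p a => by simp [ratOfCode_codeMul, hF']⟩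

/-- Positivity of finitely many polynomials can be decided on codes. -/
theorem exists_decide_eval_pos {u : σ → (ℕ → ℕ) → α → ℕ} (hu : ∀ s, OracleComputable (u s))
    (fs : List (MvPolynomial σ ℚ)) : ∃ t : (ℕ → ℕ) → α → Bool, OracleComputable t ∧
      ∀ p a, t p a = true ↔
        ∀ f ∈ fs, 0 < MvPolynomial.eval (fun s => ratOfCode (u s p a)) f := by
  induction fs with
  | nil => exact ⟨fun _ _ => true, const true, by simp⟩
  | cons f fs ih =>
    obtain ⟨t, ht, ht'⟩ := ih
    obtain ⟨g, hg, hg'⟩ := exists_ratOfCode_eq_aeval hu f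
    refine ⟨fun p a => decide (codeNeg (g p a) < codePos (g p a)) && t p a,
      comp₂ Primrec.and (comp₁ (h := fun m => decide (codeNeg m < codePos m))
        (PrimrecPred.decide (Primrec.nat_lt.comp primrec_codeNeg primrec_codePos)) hg) ht,
      fun p a => ?_⟩
    simp [ht', ← hg', ratOfCode_pos_iff]

end OracleComputable

/-! ### Polynomial Lipschitz bounds for polynomials -/

/-- The bound is itself a rational polynomial, evaluated at the approximate point `y'`; thus it can
be computed from the approximations alone. -/
theorem MvPolynomial.exists_lipschitz_bound {σ : Type*} (f : MvPolynomial σ ℚ) :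
    ∃ L : MvPolynomial σ ℚ, ∀ (y y' : σ → ℝ) (η : ℝ), η ≤ 1 → (∀ s, |y s - y' s| ≤ η) →
      0 ≤ aeval y' L ∧ |aeval y f - aeval y' f| ≤ η * aeval y' L := by
  induction f using MvPolynomial.induction_on with
  | C r => exact ⟨0, by simp⟩
  | add f g hf hg =>
    obtain ⟨F, hF⟩ := hf
    obtain ⟨G, hG⟩ := hg
    refine ⟨F + G, fun y y' η hη h => ?_⟩
    obtain ⟨hF0, hF⟩ := hF y y' η hη h
    obtain ⟨hG0, hG⟩ := hG y y' η hη h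
    simp only [map_add]
    refine ⟨by positivity, ?_⟩
    rw [add_sub_add_comm, mul_add]
    exact (abs_add_le _ _).trans (add_le_add hF hG)
  | mul_X f s hf =>
    obtain ⟨F, hF⟩ := hf
    -- Product rule, with `|t|` replaced by its polynomial majorant `1 + t ^ 2`; the `2` absorbs `|y
    -- s - y' s| ≤ 1`.
    refine ⟨F * (2 + X s ^ 2) + (1 + f ^ 2), fun y y' η hη h => ?_⟩
    obtain ⟨hF0, hF⟩ := hF y y' η hη h
    have hs := h s
    have hη0 : 0 ≤ η := (abs_nonneg _).trans hs
    have sq (t : ℝ) : |t| ≤ 1 + t ^ 2 := by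
      rw [← sq_abs]; nlinarith [sq_nonneg (|t| - 1), abs_nonneg t]
    simp only [map_add, map_mul, map_pow, aeval_X, map_one, map_ofNat]
    refine ⟨by positivity, ?_⟩
    have hy : |y s| ≤ 2 + y' s ^ 2 := by
      have h1 : |y s| ≤ |y s - y' s| + |y' s| := by
        simpa using abs_add_le (y s - y' s) (y' s)
      linarith [sq (y' s)]
    calc |aeval y f * y s - aeval y' f * y' s|
        = |(aeval y f - aeval y' f) * y s + aeval y' f * (y s - y' s)| := by ring_nf
      _ ≤ |aeval y f - aeval y' f| * |y s| + |aeval y' f| * |y s - y' s| := by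
        rw [← abs_mul, ← abs_mul]; exact abs_add_le _ _
      _ ≤ (η * aeval y' F) * (2 + y' s ^ 2) + (1 + aeval y' f ^ 2) * η := by
        gcongr
        exact sq _
      _ = _ := by ring

/-- A polynomial bounding the variation of `f` on small cubes. -/
noncomputable def MvPolynomial.lip {σ : Type*} (f : MvPolynomial σ ℚ) : MvPolynomial σ ℚ :=
  f.exists_lipschitz_bound.choose

theorem MvPolynomial.abs_aeval_sub_le {σ : Type*} (f : MvPolynomial σ ℚ) {y y' : σ → ℝ} {η : ℝ}
    (hη : η ≤ 1) (h : ∀ s, |y s - y' s| ≤ η) :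
    |aeval y f - aeval y' f| ≤ η * aeval y' f.lip :=
  (f.exists_lipschitz_bound.choose_spec y y' η hη h).2

/-- If `f` is positive at `y`, then for all sufficiently fine approximations this can be seen with
the bound `lip`, and any correction `g` of the order of the precision does no harm. -/
theorem MvPolynomial.exists_forall_lt_aeval {σ : Type*} (f g : MvPolynomial σ ℚ) (y : σ → ℝ)
    (hf : 0 < aeval y f) : ∃ ε > 0, ∀ (y' : σ → ℝ) (η : ℝ), 0 ≤ η → η ≤ ε →
      (∀ s, |y s - y' s| ≤ η) → η * aeval y' g < aeval y' f := by
  have ht : Filter.Tendsto (fun η : ℝ => aeval y f - η * aeval y f.lip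
      - η * (|aeval y g| + η * aeval y g.lip)) (nhds 0) (nhds (aeval y f)) := by
    have : Continuous (fun η : ℝ => aeval y f - η * aeval y f.lip
      - η * (|aeval y g| + η * aeval y g.lip)) := by fun_prop
    simpa using this.tendsto 0
  obtain ⟨ε, hε, h⟩ := Metric.eventually_nhds_iff.1 (ht.eventually (lt_mem_nhds hf))
  refine ⟨min 1 (ε / 2), by positivity, fun y' η h0 h1 hy => ?_⟩
  have hη1 : η ≤ 1 := h1.trans (min_le_left _ _)
  have hη2 : η ≤ ε / 2 := h1.trans (min_le_right _ _)
  have hy' : ∀ s, |y' s - y s| ≤ η := fun s => abs_sub_comm (y s) (y' s) ▸ hy s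
  have key := h (y := η) (by rw [dist_zero_right, Real.norm_of_nonneg h0]; linarith)
  have h2 := abs_le.1 (f.abs_aeval_sub_le hη1 hy')
  have h3 := abs_le.1 (g.abs_aeval_sub_le hη1 hy')
  have h4 : aeval y' g ≤ |aeval y g| + η * aeval y g.lip := by
    linarith [le_abs_self (aeval y g)]
  have h5 := mul_le_mul_of_nonneg_left h4 h0
  linarith

open Polynomial

/-! ### Idempotents near approximate idempotents -/

/-- The iteration `x ↦ 3x² - 2x³` is Newton's method for `x² = x`, with the inverse of `2x - 1`
replaced by `2x - 1`. The limit commutes with whatever commutes with `E`, because every iterate is a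
polynomial in `E`. -/
theorem exists_idempotent_near {R : Type*} [NormedRing R] [CompleteSpace R] (E : R)
    (h : ‖E * E - E‖ ≤ 1 / 16) :
    ∃ e : R, e * e = e ∧ ‖E - e‖ ≤ 2 * (‖E + E - 1‖ * ‖E * E - E‖) ∧
      ∀ x, Commute x E → Commute x e := by
  set T : R → R := fun x => x - (x + x - 1) * (x * x - x) with hT
  set u : ℕ → R := fun m => T^[m] E with hu
  set g := ‖E + E - 1‖
  set f := ‖E * E - E‖
  have hu1 : ∀ m, u (m + 1) = T (u m) := fun m => Function.iterate_succ_apply' T m E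
  -- The defect shrinks by a factor 4 while `2x - 1` at most doubles, so the steps are bounded by `g
  -- * f / 2 ^ m` and sum to at most `2 * (g * f)`.
  have key : ∀ m, ‖u m * u m - u m‖ ≤ f / 4 ^ m ∧ ‖u m + u m - 1‖ ≤ g * 2 ^ m := by
    intro m
    induction m with
    | zero => simp [hu, f, g]
    | succ m ih =>
      obtain ⟨ihf, ihg⟩ := ih
      rw [hu1]
      set x := u m
      set F := x * x - x with hF
      set G := x + x - 1 with hG
      have hf0 : 0 ≤ f := norm_nonneg _
      have hf16 : ‖F‖ ≤ 1 / 16 := ihf.trans <| (div_le_self hf0 (one_le_pow₀ (by norm_num))).trans h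
      have e1 : T x * T x - T x = 4 • (F * F * F) - 3 • (F * F) := by
        simp only [hT, hF]; noncomm_ring
      have e2 : T x + T x - 1 = G - 2 • (G * F) := by
        simp only [hT, hF, hG]; noncomm_ring
      have n0 := norm_nonneg F
      have n1 : ‖F * F‖ ≤ ‖F‖ * ‖F‖ := norm_mul_le _ _
      have n2 : ‖F * F * F‖ ≤ ‖F‖ * ‖F‖ * ‖F‖ :=
        (norm_mul_le _ _).trans (mul_le_mul_of_nonneg_right n1 n0)
      have n3 : ‖G * F‖ ≤ ‖G‖ * ‖F‖ := norm_mul_le _ _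
      have m1 : ‖4 • (F * F * F)‖ ≤ 4 * ‖F * F * F‖ := by
        simpa using norm_nsmul_le (n := 4) (a := F * F * F)
      have m2 : ‖3 • (F * F)‖ ≤ 3 * ‖F * F‖ := by simpa using norm_nsmul_le (n := 3) (a := F * F)
      have m3 : ‖2 • (G * F)‖ ≤ 2 * ‖G * F‖ := by simpa using norm_nsmul_le (n := 2) (a := G * F)
      constructor
      · rw [e1, pow_succ, ← div_div]
        have : ‖4 • (F * F * F) - 3 • (F * F)‖ ≤ ‖F‖ / 4 := by
          refine (norm_sub_le _ _).trans ?_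
          nlinarith [mul_le_mul_of_nonneg_right hf16 n0,
            mul_le_mul_of_nonneg_right hf16 (mul_nonneg n0 n0)]
        linarith
      · rw [e2, pow_succ]
        have : ‖G - 2 • (G * F)‖ ≤ ‖G‖ * 2 := by
          refine (norm_sub_le _ _).trans ?_
          nlinarith [mul_le_mul_of_nonneg_left hf16 (norm_nonneg G), norm_nonneg G]
        linarith
  have hstep : ∀ m, dist (u m) (u (m + 1)) ≤ 2 * (g * f) / 2 / 2 ^ m := by
    intro m
    rw [dist_eq_norm, hu1]
    have : u m - T (u m) = (u m + u m - 1) * (u m * u m - u m) := by simp [hT]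
    rw [this]
    refine (norm_mul_le _ _).trans ?_
    refine (mul_le_mul (key m).2 (key m).1 (norm_nonneg _) (by positivity)).trans (le_of_eq ?_)
    have : (4 : ℝ) ^ m = 2 ^ m * 2 ^ m := by rw [← mul_pow]; norm_num
    rw [this]
    field_simp
  obtain ⟨e, he⟩ := cauchySeq_tendsto_of_complete (cauchySeq_of_le_geometric_two hstep)
  refine ⟨e, ?_, ?_, ?_⟩
  · have h1 : Filter.Tendsto (fun m => u m * u m - u m) Filter.atTop (nhds (e * e - e)) :=
      (he.mul he).sub he
    have h2 : Filter.Tendsto (fun m => u m * u m - u m) Filter.atTop (nhds 0) := by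
      refine squeeze_zero_norm (fun m => (key m).1) ?_
      have := (tendsto_pow_atTop_nhds_zero_of_lt_one (r := (1 / 4 : ℝ)) (by norm_num)
        (by norm_num)).const_mul f
      simpa [div_eq_mul_inv] using this
    exact sub_eq_zero.1 (tendsto_nhds_unique h1 h2)
  · rw [← dist_eq_norm]
    exact dist_le_of_le_geometric_two_of_tendsto₀ hstep he
  · intro x hx
    have hc : ∀ m, Commute x (u m) := by
      intro m
      induction m with
      | zero => exact hx
      | succ m ih =>
        rw [hu1]
        exact ih.sub_right (((ih.add_right ih).sub_right (Commute.one_right x)).mul_right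
          ((ih.mul_right ih).sub_right ih))
    exact tendsto_nhds_unique (he.const_mul x)
      ((he.mul_const x).congr fun m => (hc m).symm)

/-! ### Polynomials with all roots in a half plane -/

/-- The polynomial with prescribed coefficients. -/
noncomputable def coeffPoly {R : Type*} [CommRing R] {n : ℕ} (c : Fin n → R) : R[X] :=
  ∑ i, C (c i) * X ^ (i : ℕ)

/-- The monic polynomial with roots `-b i ± d i * I`. -/
noncomputable def rootPoly {R : Type*} [CommRing R] {n : ℕ} (b d : Fin n → R) : R[X] :=
  ∏ i, ((X + C (b i)) ^ 2 + C (d i) ^ 2)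

theorem map_coeffPoly {R S : Type*} [CommRing R] [CommRing S] (φ : R →+* S) {n : ℕ}
    (c : Fin n → R) : (coeffPoly c).map φ = coeffPoly (φ ∘ c) := by
  simp [coeffPoly, Polynomial.map_sum]

theorem map_rootPoly {R S : Type*} [CommRing R] [CommRing S] (φ : R →+* S) {n : ℕ}
    (b d : Fin n → R) : (rootPoly b d).map φ = rootPoly (φ ∘ b) (φ ∘ d) := by
  simp [rootPoly, Polynomial.map_prod]

theorem coeffPoly_coeff {R : Type*} [CommRing R] {n : ℕ} {p : R[X]} (hp : p.degree < n) :
    coeffPoly (fun i : Fin n => p.coeff i) = p :=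
  (Polynomial.sum_fin (fun i a => C a * X ^ i) (by simp) hp).trans p.sum_C_mul_X_pow_eq

section rootPoly

variable {n : ℕ} {b d : Fin n → ℝ}

theorem aeval_rootPoly (z : ℂ) :
    aeval z (rootPoly b d) = ∏ i, ((z + b i) ^ 2 + (d i : ℂ) ^ 2) := by
  simp [rootPoly, map_prod]

/-- Each factor is a product of the distances from `z` to the two points `-b i ± d i * I`, and each
distance is at least `b i` because the real part of `z` is nonnegative. -/
theorem le_norm_aeval_rootPoly (hb : ∀ i, 0 < b i) {z : ℂ} (hz : 0 ≤ z.re) :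
    ∏ i, b i ^ 2 ≤ ‖aeval z (rootPoly b d)‖ := by
  rw [aeval_rootPoly, norm_prod]
  refine Finset.prod_le_prod (fun i _ => by positivity) fun i _ => ?_
  have h1 : (z + b i) ^ 2 + (d i : ℂ) ^ 2
      = (z + b i + d i * Complex.I) * (z + b i - d i * Complex.I) := by
    ring_nf; rw [Complex.I_sq]; ring
  rw [h1, norm_mul, sq]
  have hbi := hb i
  have h2 : b i ≤ ‖z + b i + d i * Complex.I‖ := by
    refine le_trans ?_ (Complex.re_le_norm _)
    simpa using hz
  have h3 : b i ≤ ‖z + b i - d i * Complex.I‖ := by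
    refine le_trans ?_ (Complex.re_le_norm _)
    simpa using hz
  exact mul_le_mul h2 h3 hbi.le (norm_nonneg _)

theorem le_norm_aeval_rootPoly_neg (hb : ∀ i, 0 < b i) {z : ℂ} (hz : z.re ≤ 0) :
    ∏ i, b i ^ 2 ≤ ‖aeval z (rootPoly (-b) d)‖ := by
  have : aeval z (rootPoly (-b) d) = aeval (-z) (rootPoly b d) := by
    simp only [aeval_rootPoly, Pi.neg_apply]
    refine Finset.prod_congr rfl fun i _ => ?_
    push_cast
    ring
  rw [this]
  exact le_norm_aeval_rootPoly hb (by simpa using hz)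

theorem re_neg_of_aeval_rootPoly (hb : ∀ i, 0 < b i) {z : ℂ} (h : aeval z (rootPoly b d) = 0) :
    z.re < 0 := by
  by_contra! hz
  have := le_norm_aeval_rootPoly (d := d) hb hz
  rw [h, norm_zero] at this
  exact this.not_gt (Finset.prod_pos fun i _ => pow_pos (hb i) 2)

theorem re_pos_of_aeval_rootPoly_neg (hb : ∀ i, 0 < b i) {z : ℂ}
    (h : aeval z (rootPoly (-b) d) = 0) : 0 < z.re := by
  by_contra! hz
  have := le_norm_aeval_rootPoly_neg (d := d) hb hz
  rw [h, norm_zero] at this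
  exact this.not_gt (Finset.prod_pos fun i _ => pow_pos (hb i) 2)

theorem isCoprime_rootPoly (hb : ∀ i, 0 < b i) : IsCoprime (rootPoly b d) (rootPoly (-b) d) := by
  rw [Polynomial.isCoprime_iff_aeval_ne_zero_of_isAlgClosed ℝ ℂ]
  intro z
  by_contra! h
  exact (re_neg_of_aeval_rootPoly hb h.1).asymm (re_pos_of_aeval_rootPoly_neg hb h.2)

end rootPoly

/-! ### The stable projection of a hyperbolic matrix -/

/-- The complexification of a real matrix. -/
noncomputable def complexMatrix {n : ℕ} :
    Matrix (Fin n) (Fin n) ℝ →+* Matrix (Fin n) (Fin n) ℂ :=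
  Complex.ofRealHom.mapMatrix

/-- Polynomials that separate the two halves of the spectrum of `A`. -/
structure SpectralSplitting {n : ℕ} (A : Matrix (Fin n) (Fin n) ℝ) where
  b : Fin n → ℝ
  d : Fin n → ℝ
  u : ℝ[X]
  v : ℝ[X]
  b_pos : ∀ i, 0 < b i
  bezout : u * rootPoly b d + v * rootPoly (-b) d = 1
  aeval_mul : aeval A (rootPoly b d) * aeval A (rootPoly (-b) d) = 0

section

variable {n : ℕ} {A : Matrix (Fin n) (Fin n) ℝ}

theorem complexMatrix_injective : Function.Injective (complexMatrix (n := n)) := fun A B h => by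
  ext i j
  exact Complex.ofReal_injective (congrFun (congrFun h i) j)

theorem complexMatrix_aeval (p : ℝ[X]) :
    complexMatrix (aeval A p) = aeval (complexMatrix A) (p.map Complex.ofRealHom) := by
  refine Polynomial.map_aeval_eq_aeval_map ?_ p A
  ext r i j
  by_cases h : i = j <;>
    simp [complexMatrix, Matrix.algebraMap_matrix_apply, h]

theorem complexMatrix_aeval_mulVec {z : ℂ} {w : Fin n → ℂ}
    (h : (complexMatrix A).mulVec w = z • w) (p : ℝ[X]) :
    (complexMatrix (aeval A p)).mulVec w = aeval z p • w := by
  induction p using Polynomial.induction_on' with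
  | add p q hp hq => simp [Matrix.add_mulVec, hp, hq, add_smul]
  | monomial k r =>
    induction k generalizing r with
    | zero =>
      have : complexMatrix (algebraMap ℝ (Matrix (Fin n) (Fin n) ℝ) r)
          = algebraMap ℂ (Matrix (Fin n) (Fin n) ℂ) r := by
        ext i j
        by_cases h : i = j <;>
          simp [complexMatrix, Matrix.algebraMap_matrix_apply, h]
      simp only [monomial_zero_left, aeval_C, this]
      rw [Algebra.algebraMap_eq_smul_one, Matrix.smul_mulVec, Matrix.one_mulVec]
      rfl
    | succ k ih =>
      rw [← monomial_mul_X, map_mul, map_mul, aeval_X, ← Matrix.mulVec_mulVec, h,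
        Matrix.mulVec_smul, ih, map_mul, aeval_X, smul_smul, mul_comm]

-- The square matrix all of whose columns are `w` turns the eigenvector equation into one to which
-- submultiplicativity applies.
open scoped Matrix.Norms.Frobenius in
theorem norm_le_frobenius_of_mulVec_eq_smul {M : Matrix (Fin n) (Fin n) ℂ} {μ : ℂ}
    {w : Fin n → ℂ} (hw : w ≠ 0) (h : M.mulVec w = μ • w) :
    ‖μ‖ ≤ ‖M‖ := by
  set W : Matrix (Fin n) (Fin n) ℂ := Matrix.of fun i _ => w i
  have hMW : M * W = μ • W := by
    ext i j
    simpa [Matrix.mul_apply, Matrix.mulVec, dotProduct, W] using congrFun h i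
  obtain ⟨i, hi⟩ := Function.ne_iff.1 hw
  have hW : 0 < ‖W‖ := norm_pos_iff.2 fun h0 => hi (congrFun (congrFun h0 i) i)
  have := norm_mul_le M W
  rw [hMW, norm_smul] at this
  exact le_of_mul_le_mul_right this hW

/-- `M` preserves the range of `Q`, which is a nonzero complex space fixed pointwise by `Q`; the
restriction of `M` to it has an eigenvector. -/
theorem exists_eigenvector_of_idempotent {M Q : Matrix (Fin n) (Fin n) ℂ} (hQ : Q * Q = Q)
    (hM : Commute M Q) (h0 : Q ≠ 0) :
    ∃ (z : ℂ) (w : Fin n → ℂ), w ≠ 0 ∧ M.mulVec w = z • w ∧ Q.mulVec w = w := by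
  set V := LinearMap.range (Matrix.toLin' Q)
  have hV : ∀ x ∈ V, Matrix.toLin' M x ∈ V := by
    rintro _ ⟨y, rfl⟩
    refine ⟨M.mulVec y, ?_⟩
    simp [Matrix.mulVec_mulVec, hM.eq]
  have hV0 : V ≠ ⊥ := fun h => h0 (by
    rw [LinearMap.range_eq_bot] at h
    exact Matrix.toLin'.injective (h.trans (map_zero _).symm))
  have : Nontrivial V := Submodule.nontrivial_iff_ne_bot.2 hV0
  obtain ⟨z, hz⟩ := Module.End.exists_eigenvalue ((Matrix.toLin' M).restrict hV)
  obtain ⟨⟨w, y, rfl⟩, hw⟩ := hz.exists_hasEigenvector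
  refine ⟨z, Q.mulVec y, fun h => hw.2 (Subtype.ext h), ?_, ?_⟩
  · simpa using congrArg Subtype.val hw.apply_eq_smul
  · rw [Matrix.mulVec_mulVec, hQ]

end

/-- The sum of the squares of the entries. -/
def sumSq {R : Type*} [CommRing R] {n : ℕ} (M : Matrix (Fin n) (Fin n) R) : R :=
  ∑ i, ∑ j, M i j ^ 2

-- The reason for choosing the Frobenius norm: its square is polynomial in the entries, so norm
-- bounds become polynomial inequalities.
open scoped Matrix.Norms.Frobenius in
theorem norm_complexMatrix_sq {n : ℕ} (M : Matrix (Fin n) (Fin n) ℝ) :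
    ‖complexMatrix M‖ ^ 2 = sumSq M := by
  rw [Matrix.frobenius_norm_def, ← Real.sqrt_eq_rpow, Real.sq_sqrt (by positivity)]
  simp [sumSq, complexMatrix]

theorem sumSq_mulVec_le {n : ℕ} (M : Matrix (Fin n) (Fin n) ℝ) (x : Fin n → ℝ) :
    ∑ i, M.mulVec x i ^ 2 ≤ sumSq M * ∑ i, x i ^ 2 := by
  rw [sumSq, Finset.sum_mul]
  exact Finset.sum_le_sum fun i _ => Finset.sum_mul_sq_le_sq_mul_sq Finset.univ (M i) x

theorem exists_ofFn_eq {α : Type*} {n : ℕ} (l : List α) (h : l.length = n) :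
    ∃ f : Fin n → α, List.ofFn f = l := by
  subst h
  exact ⟨l.get, List.ofFn_get l⟩

theorem exists_charpoly_eq_prod {n : ℕ} (M : Matrix (Fin n) (Fin n) ℂ) :
    ∃ z : Fin n → ℂ, M.charpoly = ∏ i, (X - C (z i)) := by
  have hs := IsAlgClosed.splits M.charpoly
  obtain ⟨z, hz⟩ := exists_ofFn_eq (n := n) M.charpoly.roots.toList (by
    rw [Multiset.length_toList, ← hs.natDegree_eq_card_roots, Matrix.charpoly_natDegree_eq_dim,
      Fintype.card_fin])
  refine ⟨z, ?_⟩
  rw [hs.eq_prod_roots, M.charpoly_monic.leadingCoeff, C_1, one_mul, ← Multiset.coe_toList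
    M.charpoly.roots, ← hz]
  simp [List.prod_ofFn, Function.comp_def]

namespace SpectralSplitting

variable {n : ℕ} {A : Matrix (Fin n) (Fin n) ℝ}

/-- A hyperbolic matrix has a spectral splitting. -/
theorem nonempty_of_hyperbolic (hA : IsHyperbolicMatrix A) : Nonempty (SpectralSplitting A) := by
  obtain ⟨z, hz⟩ := exists_charpoly_eq_prod (complexMatrix A)
  have hre : ∀ i, (z i).re ≠ 0 := fun i => by
    refine hA _ (Module.End.hasEigenvalue_iff_mem_spectrum.2 ?_)
    change z i ∈ spectrum ℂ (Matrix.toLin' (complexMatrix A))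
    rw [Matrix.spectrum_toLin', Matrix.mem_spectrum_iff_isRoot_charpoly, hz, IsRoot, eval_prod]
    exact Finset.prod_eq_zero (Finset.mem_univ i) (by simp)
  -- No sorting of eigenvalues is needed: `z i` is a root of the `i`-th factor of `rootPoly b d` or
  -- of `rootPoly (-b) d`, according to the sign of its real part. So the characteristic polynomial
  -- divides the product, and Cayley–Hamilton applies.
  set b : Fin n → ℝ := fun i => |(z i).re|
  set d : Fin n → ℝ := fun i => (z i).im
  have hb : ∀ i, 0 < b i := fun i => abs_pos.2 (hre i)
  obtain ⟨u, v, huv⟩ := isCoprime_rootPoly (d := d) hb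
  refine ⟨⟨b, d, u, v, hb, huv, ?_⟩⟩
  apply complexMatrix_injective
  rw [← map_mul, complexMatrix_aeval, map_zero]
  have hdvd : (complexMatrix A).charpoly ∣
      (rootPoly b d * rootPoly (-b) d).map Complex.ofRealHom := by
    rw [hz, Polynomial.map_mul, map_rootPoly, map_rootPoly, rootPoly, rootPoly,
      ← Finset.prod_mul_distrib]
    refine Finset.prod_dvd_prod_of_dvd _ _ fun i _ => ?_
    rw [dvd_iff_isRoot, IsRoot]
    have hI : ((z i).im * Complex.I : ℂ) ^ 2 + ((z i).im : ℂ) ^ 2 = 0 := by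
      rw [mul_pow, Complex.I_sq]; ring
    simp only [Function.comp_apply, Complex.ofRealHom_eq_coe, Pi.neg_apply, eval_mul, eval_add,
      eval_pow, eval_X, eval_C, b, d, mul_eq_zero]
    rcases abs_choice (z i).re with h | h <;> rw [h]
    · right
      convert hI using 3
      nth_rewrite 1 [← Complex.re_add_im (z i)]
      push_cast
      ring
    · left
      convert hI using 3
      nth_rewrite 1 [← Complex.re_add_im (z i)]
      push_cast
      ring
  obtain ⟨r, hr⟩ := hdvd
  rw [hr, map_mul, Matrix.aeval_self_charpoly, zero_mul]

variable (S : SpectralSplitting A)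

/-- The projection onto the stable subspace along the unstable one. -/
noncomputable def proj : Matrix (Fin n) (Fin n) ℝ := aeval A (S.v * rootPoly (-S.b) S.d)

theorem one_sub_proj : 1 - S.proj = aeval A (S.u * rootPoly S.b S.d) := by
  rw [proj, sub_eq_iff_eq_add, ← map_add, S.bezout, map_one]

theorem proj_mul_aeval : S.proj * aeval A (rootPoly S.b S.d) = 0 := by
  rw [proj, ← map_mul, mul_assoc, mul_comm (rootPoly (-S.b) S.d), map_mul, map_mul, S.aeval_mul,
    mul_zero]

theorem one_sub_proj_mul_aeval : (1 - S.proj) * aeval A (rootPoly (-S.b) S.d) = 0 := by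
  rw [one_sub_proj, ← map_mul, mul_assoc, map_mul, map_mul, S.aeval_mul, mul_zero]

theorem proj_mul_proj : S.proj * S.proj = S.proj := by
  have hP : aeval A (rootPoly (-S.b) S.d) * aeval A S.v = S.proj := by
    rw [proj, mul_comm S.v, map_mul]
  have h : (1 - S.proj) * S.proj = 0 := by
    calc (1 - S.proj) * S.proj
        = (1 - S.proj) * (aeval A (rootPoly (-S.b) S.d) * aeval A S.v) := by rw [hP]
      _ = 0 := by rw [← mul_assoc, S.one_sub_proj_mul_aeval, zero_mul]
  rw [sub_mul, one_mul, sub_eq_zero] at h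
  exact h.symm

/-- Reduction modulo the characteristic polynomial; it shows that a search over `n` coefficients
suffices. -/
theorem exists_coeff : ∃ c : Fin n → ℝ, aeval A (coeffPoly c) = S.proj := by
  refine ⟨fun i => ((S.v * rootPoly (-S.b) S.d) %ₘ A.charpoly).coeff i, ?_⟩
  rw [coeffPoly_coeff, proj, aeval_modByMonic_eq_self_of_root (A.aeval_self_charpoly)]
  refine (degree_modByMonic_lt _ A.charpoly_monic).trans_le ?_
  rw [Matrix.charpoly_degree_eq_dim, Fintype.card_fin]

theorem aeval_bezout (z : ℂ) : aeval z S.u * aeval z (rootPoly S.b S.d)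
    + aeval z S.v * aeval z (rootPoly (-S.b) S.d) = 1 := by
  simpa using congrArg (aeval z) S.bezout

theorem aeval_mul_eq_zero {z : ℂ} {w : Fin n → ℂ} (hw : w ≠ 0)
    (h : (complexMatrix A).mulVec w = z • w) :
    aeval z (rootPoly S.b S.d) * aeval z (rootPoly (-S.b) S.d) = 0 := by
  have := complexMatrix_aeval_mulVec h (rootPoly S.b S.d * rootPoly (-S.b) S.d)
  rw [map_mul, S.aeval_mul, map_zero, Matrix.zero_mulVec, map_mul] at this
  exact (smul_eq_zero.1 this.symm).resolve_right hw

theorem re_pos_of_proj_mulVec {z : ℂ} {w : Fin n → ℂ} (hw : w ≠ 0)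
    (h : (complexMatrix A).mulVec w = z • w) (hP : (complexMatrix S.proj).mulVec w = 0) :
    0 < z.re := by
  rw [proj, complexMatrix_aeval_mulVec h, smul_eq_zero, or_iff_left hw, map_mul] at hP
  have h1 := S.aeval_bezout z
  rw [hP, add_zero] at h1
  exact re_pos_of_aeval_rootPoly_neg S.b_pos
    ((mul_eq_zero.1 (S.aeval_mul_eq_zero hw h)).resolve_left (right_ne_zero_of_mul_eq_one h1))

theorem re_neg_of_proj_mulVec {z : ℂ} {w : Fin n → ℂ} (hw : w ≠ 0)
    (h : (complexMatrix A).mulVec w = z • w) (hP : (complexMatrix S.proj).mulVec w = w) :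
    z.re < 0 := by
  rw [proj, complexMatrix_aeval_mulVec h, map_mul] at hP
  have h1 : aeval z S.v * aeval z (rootPoly (-S.b) S.d) = 1 :=
    smul_left_injective ℂ hw (hP.trans (one_smul ℂ w).symm)
  exact re_neg_of_aeval_rootPoly S.b_pos
    ((mul_eq_zero.1 (S.aeval_mul_eq_zero hw h)).resolve_right (right_ne_zero_of_mul_eq_one h1))

/-- On a generalized eigenspace for `z`, the operator `q(A)` is invertible because `q` is coprime to
the powers of `X - z`; so `w` lies in the image of `q(A)`, which `p(A)` kills. -/
theorem mulVec_eq_zero_of_mem_maxGenEigenspace {p q : ℝ[X]} (hpq : aeval A p * aeval A q = 0)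
    {z : ℂ} (hz : aeval z q ≠ 0) {w : Fin n → ℂ} (hw : w ∈ (complexEnd A).maxGenEigenspace z) :
    (complexMatrix (aeval A p)).mulVec w = 0 := by
  obtain ⟨k, hk⟩ := (Module.End.mem_maxGenEigenspace _ _ _).1 hw
  have hco : IsCoprime ((X - C z) ^ k) (q.map Complex.ofRealHom) := by
    refine IsCoprime.pow_left ((irreducible_X_sub_C z).coprime_iff_not_dvd.2 fun h => hz ?_)
    rw [dvd_iff_isRoot, IsRoot, eval_map] at h
    exact h
  obtain ⟨r, s, hrs⟩ := hco
  have hk' : (aeval (complexMatrix A) ((X - C z) ^ k)).mulVec w = 0 := by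
    have : Matrix.toLinAlgEquiv' (aeval (complexMatrix A) ((X - C z) ^ k))
        = (complexEnd A - z • 1) ^ k := by
      rw [map_pow, map_pow, map_sub, map_sub, aeval_X, aeval_C,
        Algebra.algebraMap_eq_smul_one, map_smul, map_one]
      rfl
    rw [← this] at hk
    exact hk
  have h1 : w = (aeval (complexMatrix A) (q.map Complex.ofRealHom * s)).mulVec w := by
    conv_lhs => rw [← Matrix.one_mulVec w, ← map_one (aeval (R := ℂ) (complexMatrix A)), ← hrs, map_add,
      Matrix.add_mulVec, map_mul, ← Matrix.mulVec_mulVec, hk', Matrix.mulVec_zero, zero_add,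
      mul_comm s]
  rw [h1, map_mul, Matrix.mulVec_mulVec, ← mul_assoc, ← complexMatrix_aeval, ← map_mul, hpq,
    map_zero, zero_mul, Matrix.zero_mulVec]

theorem complexMatrix_mulVec_re (M : Matrix (Fin n) (Fin n) ℝ) (w : Fin n → ℂ) (i : Fin n) :
    ((complexMatrix M).mulVec w i).re = M.mulVec (fun j => (w j).re) i := by
  simp [complexMatrix, Matrix.mulVec, dotProduct]

theorem complexMatrix_mulVec_im (M : Matrix (Fin n) (Fin n) ℝ) (w : Fin n → ℂ) (i : Fin n) :
    ((complexMatrix M).mulVec w i).im = M.mulVec (fun j => (w j).im) i := by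
  simp [complexMatrix, Matrix.mulVec, dotProduct]

theorem proj_mulVec_eq_self {z : ℂ} (hz : z.re ≤ 0) {w : Fin n → ℂ}
    (hw : w ∈ (complexEnd A).maxGenEigenspace z) : (complexMatrix S.proj).mulVec w = w := by
  have h := mulVec_eq_zero_of_mem_maxGenEigenspace (A := A) (p := S.u * rootPoly S.b S.d)
    (q := rootPoly (-S.b) S.d) (by rw [← S.one_sub_proj, S.one_sub_proj_mul_aeval])
    (fun h => (re_pos_of_aeval_rootPoly_neg S.b_pos h).not_ge hz) hw
  rw [← S.one_sub_proj, map_sub, map_one, Matrix.sub_mulVec, Matrix.one_mulVec, sub_eq_zero] at h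
  exact h.symm

theorem proj_mulVec_eq_zero {z : ℂ} (hz : 0 ≤ z.re) {w : Fin n → ℂ}
    (hw : w ∈ (complexEnd A).maxGenEigenspace z) : (complexMatrix S.proj).mulVec w = 0 :=
  mulVec_eq_zero_of_mem_maxGenEigenspace (q := rootPoly S.b S.d) S.proj_mul_aeval
    (fun h => (re_neg_of_aeval_rootPoly S.b_pos h).not_ge hz) hw

theorem mem_spectralSubspace_iff (x : EuclideanSpace ℝ (Fin n)) :
    x ∈ spectralSubspace A {z | z.re < 0} ↔ S.proj.mulVec x.ofLp = x.ofLp := by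
  constructor
  · intro hx
    induction hx using Submodule.span_induction with
    | mem x hx =>
      obtain ⟨z, hz, w, hw, rfl | rfl⟩ := hx
      · funext i
        rw [← complexMatrix_mulVec_re, S.proj_mulVec_eq_self (le_of_lt hz) hw]
      · funext i
        rw [← complexMatrix_mulVec_im, S.proj_mulVec_eq_self (le_of_lt hz) hw]
    | zero => simp
    | add x y _ _ hx hy => simp [Matrix.mulVec_add, hx, hy]
    | smul r x _ hx => simp [Matrix.mulVec_smul, hx]
  · intro hx
    -- Passing to complex vectors allows induction over the decomposition of `ℂⁿ` into generalized
    -- eigenspaces, on each of which the projection is the identity or zero.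
    have key : ∀ w : Fin n → ℂ, WithLp.toLp 2 (fun i => ((complexMatrix S.proj).mulVec w i).re)
        ∈ spectralSubspace A {z | z.re < 0} := by
      intro w
      have hw : w ∈ ⨆ z, (complexEnd A).maxGenEigenspace z := by
        rw [Module.End.iSup_maxGenEigenspace_eq_top]; trivial
      refine Submodule.iSup_induction _ (motive := fun w =>
        WithLp.toLp 2 (fun i => ((complexMatrix S.proj).mulVec w i).re)
          ∈ spectralSubspace A {z | z.re < 0}) hw (fun z w hw => ?_) ?_ fun w w' h h' => ?_
      · rcases lt_or_ge z.re 0 with hz | hz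
        · rw [S.proj_mulVec_eq_self hz.le hw]
          exact Submodule.subset_span ⟨z, hz, w, hw, .inl rfl⟩
        · rw [S.proj_mulVec_eq_zero hz hw]
          exact Submodule.zero_mem _
      · rw [Matrix.mulVec_zero]
        exact Submodule.zero_mem _
      · convert Submodule.add_mem _ h h' using 1
        ext i
        simp [Matrix.mulVec_add]
    convert key (fun i => (x i : ℂ)) using 1
    ext i
    simp [complexMatrix_mulVec_re, hx]

open scoped Matrix.Norms.Frobenius in
/-- A polynomial in `A` that is nearly idempotent and that is small on the stable and near one on
the unstable part of the spectrum is close to the stable projection. -/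
theorem sumSq_sub_proj_lt (q : ℝ[X]) {E : Matrix (Fin n) (Fin n) ℝ} (hE : E = aeval A q)
    {b d : Fin n → ℝ} {δ : ℝ} (hb : ∀ i, 0 < b i)
    (h1 : 16 * sumSq (E * aeval A (rootPoly b d)) < (∏ i, b i ^ 2) ^ 2)
    (h2 : 16 * sumSq ((1 - E) * aeval A (rootPoly (-b) d)) < (∏ i, b i ^ 2) ^ 2)
    (h3 : 256 * sumSq (E * E - E) < 1)
    (h4 : 4 * (sumSq (E + E - 1) * sumSq (E * E - E)) < δ ^ 2) (h5 : 16 * δ ^ 2 < 1) :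
    sumSq (E - S.proj) < δ ^ 2 := by
  set EC := complexMatrix E with hEC
  set PC := complexMatrix S.proj with hPC
  have hβ : 0 < ∏ i, b i ^ 2 := Finset.prod_pos fun i _ => pow_pos (hb i) 2
  simp only [← norm_complexMatrix_sq] at h1 h2 h3 h4 ⊢
  simp only [map_sub, map_mul, map_add, map_one] at h1 h2 h3 h4 ⊢
  simp only [← hEC, ← hPC] at h1 h2 h3 h4 ⊢
  have h3' : ‖EC * EC - EC‖ ≤ 1 / 16 := by nlinarith [norm_nonneg (EC * EC - EC)]
  obtain ⟨e, hee, hEe, hcomm⟩ := exists_idempotent_near EC h3'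
  have hEe2 : ‖EC - e‖ ^ 2 < δ ^ 2 := by
    refine (pow_le_pow_left₀ (norm_nonneg _) hEe 2).trans_lt ?_
    rw [mul_pow, mul_pow]
    linarith
  have hEe4 : ‖EC - e‖ < 1 / 4 := by nlinarith [norm_nonneg (EC - e)]
  have cAE : Commute (complexMatrix A) EC := by
    rw [hEC, hE]
    have h : Commute (aeval A (X : ℝ[X])) (aeval A q) := (Commute.all _ _).map (aeval A)
    rw [aeval_X] at h
    exact h.map complexMatrix
  have cAP : Commute (complexMatrix A) PC := by
    rw [hPC, proj]
    have h : Commute (aeval A (X : ℝ[X])) (aeval A (S.v * rootPoly (-S.b) S.d)) :=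
      (Commute.all _ _).map (aeval A)
    rw [aeval_X] at h
    exact h.map complexMatrix
  have cPE : Commute PC EC := by
    rw [hPC, hEC, hE, proj]
    exact ((Commute.all (S.v * rootPoly (-S.b) S.d) q).map (aeval A)).map complexMatrix
  have cAe := hcomm _ cAE
  have cPe := hcomm _ cPE
  have hPP : PC * PC = PC := by rw [hPC, ← map_mul, S.proj_mul_proj]
  have hE1 : ∀ {z : ℂ} {w : Fin n → ℂ}, (complexMatrix A).mulVec w = z • w →
      EC.mulVec w = aeval z q • w := fun h => by
    rw [hEC, hE]; exact complexMatrix_aeval_mulVec h q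
  -- Otherwise there is an eigenvector `w` of `A` fixed by `e` and killed by `PC`. Its eigenvalue
  -- `z` has positive real part, so `|f(z)| ≥ β`, and `|q(z) - 1| < 1/4`; thus `‖E f(A)‖ ≥ 3β/4`,
  -- against the bound `β/4` from `h1`.
  have hz1 : e * (1 - PC) = 0 := by
    by_contra h0
    have c1 : Commute e (1 - PC) := (Commute.one_right e).sub_right cPe.symm
    have hi : (1 - PC) * (1 - PC) = 1 - PC := by
      rw [mul_sub, sub_mul, sub_mul, hPP]; simp
    obtain ⟨z, w, hw, hAw, hQw⟩ := exists_eigenvector_of_idempotent (M := complexMatrix A)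
      (by rw [c1.symm.mul_mul_mul_comm, hee, hi])
      (cAe.mul_right ((Commute.one_right _).sub_right cAP)) h0
    have hew : e.mulVec w = w := by
      conv_lhs => rw [← hQw, Matrix.mulVec_mulVec, ← mul_assoc, hee, hQw]
    have hPw : PC.mulVec w = 0 := by
      rw [← hQw, Matrix.mulVec_mulVec, ← mul_assoc, cPe.eq, mul_assoc, mul_sub, hPP]
      simp
    have hre := S.re_pos_of_proj_mulVec hw hAw hPw
    have n1 : ‖aeval z q * aeval z (rootPoly b d)‖
        ≤ ‖EC * complexMatrix (aeval A (rootPoly b d))‖ := by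
      refine norm_le_frobenius_of_mulVec_eq_smul hw ?_
      rw [← Matrix.mulVec_mulVec, complexMatrix_aeval_mulVec hAw, Matrix.mulVec_smul, hE1 hAw,
        smul_smul, mul_comm]
    have n2 : ‖aeval z q - 1‖ ≤ ‖EC - e‖ := by
      refine norm_le_frobenius_of_mulVec_eq_smul hw ?_
      rw [Matrix.sub_mulVec, hE1 hAw, hew, sub_smul, one_smul]
    have n3 := le_norm_aeval_rootPoly (d := d) hb hre.le
    have n4 : (1 : ℝ) ≤ ‖aeval z q‖ + ‖aeval z q - 1‖ := by
      simpa using norm_sub_le (aeval z q) (aeval z q - 1)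
    rw [norm_mul] at n1
    have n5 : 3 / 4 * ∏ i, b i ^ 2 ≤ ‖EC * complexMatrix (aeval A (rootPoly b d))‖ :=
      (mul_le_mul (by linarith) n3 hβ.le (norm_nonneg _)).trans n1
    nlinarith
  -- The mirror image: now `e` kills `w`, `PC` fixes it, the real part of `z` is negative, and `h2`
  -- is contradicted.
  have hz2 : (1 - e) * PC = 0 := by
    by_contra h0
    have c1 : Commute (1 - e) PC := (Commute.one_left PC).sub_left cPe.symm
    have hi : (1 - e) * (1 - e) = 1 - e := by
      rw [mul_sub, sub_mul, sub_mul, hee]; simp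
    obtain ⟨z, w, hw, hAw, hQw⟩ := exists_eigenvector_of_idempotent (M := complexMatrix A)
      (by rw [c1.symm.mul_mul_mul_comm, hPP, hi])
      (((Commute.one_right _).sub_right cAe).mul_right cAP) h0
    have hew : e.mulVec w = 0 := by
      rw [← hQw, Matrix.mulVec_mulVec, ← mul_assoc, mul_sub, hee]
      simp
    have hPw : PC.mulVec w = w := by
      conv_lhs => rw [← hQw, Matrix.mulVec_mulVec, ← mul_assoc, c1.symm.eq, mul_assoc, hPP, hQw]
    have hre := S.re_neg_of_proj_mulVec hw hAw hPw
    have n1 : ‖(1 - aeval z q) * aeval z (rootPoly (-b) d)‖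
        ≤ ‖(1 - EC) * complexMatrix (aeval A (rootPoly (-b) d))‖ := by
      refine norm_le_frobenius_of_mulVec_eq_smul hw ?_
      rw [← Matrix.mulVec_mulVec, complexMatrix_aeval_mulVec hAw, Matrix.mulVec_smul,
        Matrix.sub_mulVec, hE1 hAw, Matrix.one_mulVec, mul_comm, mul_smul, sub_smul, one_smul]
    have n2 : ‖aeval z q‖ ≤ ‖EC - e‖ := by
      refine norm_le_frobenius_of_mulVec_eq_smul hw ?_
      rw [Matrix.sub_mulVec, hE1 hAw, hew, sub_zero]
    have n3 := le_norm_aeval_rootPoly_neg (d := d) hb hre.le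
    have n4 : (1 : ℝ) ≤ ‖1 - aeval z q‖ + ‖aeval z q‖ := by
      simpa using norm_add_le (1 - aeval z q) (aeval z q)
    rw [norm_mul] at n1
    have n5 : 3 / 4 * ∏ i, b i ^ 2 ≤ ‖(1 - EC) * complexMatrix (aeval A (rootPoly (-b) d))‖ :=
      (mul_le_mul (by linarith) n3 hβ.le (norm_nonneg _)).trans n1
    nlinarith
  have heP : e = PC := by
    rw [mul_sub, mul_one, sub_eq_zero] at hz1
    rw [sub_mul, one_mul, sub_eq_zero] at hz2
    rw [hz1, ← hz2]
  rwa [heP] at hEe2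

end SpectralSplitting

/-! ### Certificates for approximations of the stable projection -/

/-- The quantities that occur in a certificate: the entries of the matrix, the coefficients of the
polynomial that approximates the projection, the real and imaginary parts of the approximate
eigenvalues, a point, an error bound, a tolerance, and the precision of the data. -/
inductive CertVar (n : ℕ) : Type
  | entry : Fin n → Fin n → CertVar n
  | coeff : Fin n → CertVar n
  | re : Fin n → CertVar n
  | im : Fin n → CertVar n
  | point : Fin n → CertVar n
  | err : CertVar n
  | tol : CertVar n
  | prec : CertVar n

namespace CertVar

variable {n : ℕ}

/-- Polynomials in the quantities of a certificate. -/
abbrev Poly (n : ℕ) : Type := MvPolynomial (CertVar n) ℚ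

/-- The matrix with given entries. -/
def toMatrix {R : Type*} (y : CertVar n → R) : Matrix (Fin n) (Fin n) R :=
  Matrix.of fun i j => y (entry i j)

section CommRing

variable {R : Type*} [CommRing R] (y : CertVar n → R)

/-- The approximate projection. -/
noncomputable def approxProj : Matrix (Fin n) (Fin n) R :=
  aeval (toMatrix y) (coeffPoly fun i => y (coeff i))

/-- The image of the point under the approximate projection. -/
noncomputable def approxPoint (i : Fin n) : R := (approxProj y).mulVec (fun j => y (point j)) i

/-- The error in the image of the point under the complementary projection has to be smaller than
this number. -/
noncomputable def defect : R := ∑ i, ((1 - approxProj y).mulVec (fun j => y (point j)) i) ^ 2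

/-- The squared norm of the point. -/
def pointSq : R := ∑ i, y (point i) ^ 2

/-- Quantities whose positivity certifies the approximate projection. -/
noncomputable def certificate : List R :=
  (List.finRange n).map (fun i => y (re i)) ++
  [(∏ i, y (re i) ^ 2) ^ 2 - 16 * sumSq (approxProj y *
      aeval (toMatrix y) (rootPoly (fun i => y (re i)) fun i => y (im i))),
    (∏ i, y (re i) ^ 2) ^ 2 - 16 * sumSq ((1 - approxProj y) *
      aeval (toMatrix y) (rootPoly (fun i => -y (re i)) fun i => y (im i))),
    1 - 256 * sumSq (approxProj y * approxProj y - approxProj y),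
    y err ^ 2 - 4 * (sumSq (approxProj y + approxProj y - 1) *
      sumSq (approxProj y * approxProj y - approxProj y)),
    1 - 16 * y err ^ 2]

variable {S : Type*} [CommRing S] (φ : R →+* S)

/-- The certificate quantities are defined over any commutative ring and commute with ring
homomorphisms. So their instances at `MvPolynomial.X` are polynomials whose values at `y` are the
instances at `y`. -/
theorem mapMatrix_aeval (M : Matrix (Fin n) (Fin n) R) (p : R[X]) :
    φ.mapMatrix (aeval M p) = aeval (φ.mapMatrix M) (p.map φ) := by
  refine Polynomial.map_aeval_eq_aeval_map ?_ p M
  ext r i j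
  by_cases h : i = j <;> simp [Matrix.algebraMap_matrix_apply, h]

theorem map_sumSq (M : Matrix (Fin n) (Fin n) R) : φ (sumSq M) = sumSq (φ.mapMatrix M) := by
  simp [sumSq]

theorem map_toMatrix : φ.mapMatrix (toMatrix y) = toMatrix (φ ∘ y) := rfl

theorem map_approxProj : φ.mapMatrix (approxProj y) = approxProj (φ ∘ y) := by
  rw [approxProj, mapMatrix_aeval, map_coeffPoly]
  rfl

theorem map_mulVec (M : Matrix (Fin n) (Fin n) R) (x : Fin n → R) (i : Fin n) :
    φ (M.mulVec x i) = (φ.mapMatrix M).mulVec (φ ∘ x) i := by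
  simp [Matrix.mulVec, dotProduct]

theorem map_approxPoint (i : Fin n) : φ (approxPoint y i) = approxPoint (φ ∘ y) i := by
  rw [approxPoint, map_mulVec, map_approxProj]
  rfl

theorem map_defect : φ (defect y) = defect (φ ∘ y) := by
  simp only [defect, map_sum, map_pow, map_mulVec, map_sub, map_one, map_approxProj]
  rfl

theorem map_pointSq : φ (pointSq y) = pointSq (φ ∘ y) := by simp [pointSq]

theorem map_certificate : (certificate y).map φ = certificate (φ ∘ y) := by
  have hpos : φ ∘ (fun i => y (re i)) = fun i => (φ ∘ y) (re i) := rfl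
  have him : φ ∘ (fun i => y (im i)) = fun i => (φ ∘ y) (im i) := rfl
  have hneg : φ ∘ (fun i => -y (re i)) = fun i => -(φ ∘ y) (re i) := by
    funext i
    simp
  simp only [certificate, List.map_append, List.map_map, List.map_cons, List.map_nil, map_sub,
    map_mul, map_pow, map_prod, map_sumSq, map_add, map_one, map_ofNat, map_approxProj,
    mapMatrix_aeval, map_rootPoly, map_toMatrix, hneg, hpos, him]
  rfl

end CommRing

theorem map_aeval_X (y : CertVar n → ℝ) :
    ((MvPolynomial.aeval y : Poly n →ₐ[ℚ] ℝ) : Poly n →+* ℝ) ∘ MvPolynomial.X = y := by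
  funext s
  simp

theorem aeval_approxPoint (y : CertVar n → ℝ) (i : Fin n) :
    MvPolynomial.aeval y (approxPoint (MvPolynomial.X : _ → Poly n) i) = approxPoint y i := by
  have := map_approxPoint MvPolynomial.X ((MvPolynomial.aeval y : Poly n →ₐ[ℚ] ℝ) : Poly n →+* ℝ) i
  rwa [map_aeval_X] at this

theorem aeval_defect (y : CertVar n → ℝ) :
    MvPolynomial.aeval y (defect (MvPolynomial.X : _ → Poly n)) = defect y := by
  have := map_defect MvPolynomial.X ((MvPolynomial.aeval y : Poly n →ₐ[ℚ] ℝ) : Poly n →+* ℝ)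
  rwa [map_aeval_X] at this

theorem aeval_pointSq (y : CertVar n → ℝ) :
    MvPolynomial.aeval y (pointSq (MvPolynomial.X : _ → Poly n)) = pointSq y := by
  have := map_pointSq MvPolynomial.X ((MvPolynomial.aeval y : Poly n →ₐ[ℚ] ℝ) : Poly n →+* ℝ)
  rwa [map_aeval_X] at this

theorem aeval_certificate (y : CertVar n → ℝ) :
    (certificate (MvPolynomial.X : _ → Poly n)).map (MvPolynomial.aeval y) = certificate y := by
  have := map_certificate MvPolynomial.X ((MvPolynomial.aeval y : Poly n →ₐ[ℚ] ℝ) : Poly n →+* ℝ)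
  rwa [map_aeval_X] at this

theorem sumSq_approxProj_sub_proj_lt {A : Matrix (Fin n) (Fin n) ℝ} (S : SpectralSplitting A)
    {y : CertVar n → ℝ} (hA : toMatrix y = A) (h : ∀ t ∈ certificate y, 0 < t) :
    sumSq (approxProj y - S.proj) < y err ^ 2 := by
  simp only [certificate, List.mem_append, List.mem_map, List.mem_finRange, true_and,
    List.mem_cons, List.not_mem_nil, or_false] at h
  refine S.sumSq_sub_proj_lt _ (by rw [approxProj, hA])
    (fun i => h _ (.inl ⟨i, rfl⟩)) (d := fun i => y (im i)) ?_ ?_ ?_ ?_ ?_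
  · rw [← hA]; exact sub_pos.1 (h _ (by tauto))
  · rw [← hA]; exact sub_pos.1 (h _ (.inr (.inr (.inl rfl))))
  · exact sub_pos.1 (h _ (by tauto))
  · exact sub_pos.1 (h _ (by tauto))
  · exact sub_pos.1 (h _ (by tauto))

/-- Every stable projection has certificates, with arbitrarily small error bounds. -/
theorem exists_certificate {A : Matrix (Fin n) (Fin n) ℝ} (S : SpectralSplitting A)
    (x : Fin n → ℝ) {δ : ℝ} (h0 : 0 < δ) (h1 : δ < 1 / 4) (τ : ℝ) :
    ∃ y : CertVar n → ℝ, toMatrix y = A ∧ (∀ i, y (point i) = x i) ∧ y err = δ ∧ y tol = τ ∧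
      y prec = 0 ∧ approxProj y = S.proj ∧ ∀ t ∈ certificate y, 0 < t := by
  obtain ⟨c, hc⟩ := S.exists_coeff
  let y : CertVar n → ℝ
    | entry i j => A i j
    | coeff i => c i
    | re i => S.b i
    | im i => S.d i
    | point i => x i
    | err => δ
    | tol => τ
    | prec => 0
  have hP : approxProj y = S.proj := hc
  have hz : sumSq (0 : Matrix (Fin n) (Fin n) ℝ) = 0 := by simp [sumSq]
  have hβ : 0 < ∏ i, S.b i ^ 2 := Finset.prod_pos fun i _ => pow_pos (S.b_pos i) 2
  -- With `approxProj y = S.proj` all residuals vanish, so the inequalities reduce to the positivity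
  -- of `b i`, `β`, `δ` and `1 - 16 * δ ^ 2`.
  have e1 : S.proj * aeval (toMatrix y) (rootPoly (fun i => y (re i)) fun i => y (im i)) = 0 :=
    S.proj_mul_aeval
  have e2 : (1 - S.proj) * aeval (toMatrix y) (rootPoly (fun i => -y (re i)) fun i => y (im i))
      = 0 := S.one_sub_proj_mul_aeval
  refine ⟨y, rfl, fun _ => rfl, rfl, rfl, rfl, hP, fun t ht => ?_⟩
  rw [certificate, hP, e1, e2, S.proj_mul_proj, sub_self, hz] at ht
  simp only [List.mem_append, List.mem_map, List.mem_finRange, true_and,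
    List.mem_cons, List.not_mem_nil, or_false] at ht
  rcases ht with ⟨i, rfl⟩ | rfl | rfl | rfl | rfl | rfl
  · exact S.b_pos i
  · simp only [mul_zero, sub_zero]; exact pow_pos hβ 2
  · simp only [mul_zero, sub_zero]; exact pow_pos hβ 2
  · norm_num
  · simp only [mul_zero, sub_zero]; exact pow_pos h0 2
  · change 0 < 1 - 16 * δ ^ 2
    nlinarith

/-! ### Coding of certificates and tests that are robust under approximation -/

/-- The position of a quantity in the list that codes a certificate. -/
def index : CertVar n → ℕ
  | coeff i => Nat.pair 0 i
  | re i => Nat.pair 1 i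
  | im i => Nat.pair 2 i
  | point i => Nat.pair 3 i
  | err => Nat.pair 4 0
  | tol => Nat.pair 5 0
  | prec => Nat.pair 6 0
  | entry i j => Nat.pair 7 (Nat.pair i j)

theorem index_injective : Function.Injective (index (n := n)) := by
  intro s t h
  cases s <;> cases t <;> simp_all [index, Nat.pair_eq_pair, Fin.ext_iff]

theorem exists_listEntry_index_eq (c : CertVar n → ℕ) :
    ∃ w, ∀ s, (∀ i j, s ≠ entry i j) → listEntry (index s) w = c s := by
  obtain ⟨w, hw⟩ := exists_listEntry_eq ((n + 8) ^ 2) (Function.extend index c 0)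
  refine ⟨w, fun s hs => ?_⟩
  rw [hw, index_injective.extend_apply]
  have key : ∀ a b : ℕ, a ≤ n + 7 → b ≤ n + 7 → Nat.pair a b < (n + 8) ^ 2 := fun a b ha hb =>
    (Nat.pair_lt_max_add_one_sq a b).trans_le (Nat.pow_le_pow_left (by omega) 2)
  cases s with
  | entry i j => exact absurd rfl (hs i j)
  | _ => exact key _ _ (by omega) (by omega)

/-- The code of a quantity: the entries of the matrix are read off the name `p` with precision
`2 ^ (-N)`, the other quantities from the list coded by `w`. -/
def code (p : ℕ → ℕ) (w N : ℕ) : CertVar n → ℕ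
  | entry i j => p (Nat.pair i (Nat.pair j N))
  | prec => codeTwoPow N
  | s => listEntry (index s) w

/-- The code of a quantity, with prescribed point and tolerance. -/
def pointCode (p : ℕ → ℕ) (l t w N : ℕ) : CertVar n → ℕ
  | point i => listEntry i l
  | tol => codeTwoPow t
  | s => code p w N s

/-- The rational numbers with given codes, as real numbers. -/
def value (c : CertVar n → ℕ) (s : CertVar n) : ℝ := ratOfCode (c s)

theorem cast_eval (c : CertVar n → ℕ) (f : Poly n) :
    ((MvPolynomial.eval (fun s => ratOfCode (c s)) f : ℚ) : ℝ)
      = MvPolynomial.aeval (value c) f :=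
  (MvPolynomial.aeval_algebraMap_apply ℝ (fun s => ratOfCode (c s)) f).symm

/-- The polynomial `f`, diminished by a multiple of the precision. -/
noncomputable def diminish (fg : Poly n × Poly n) : Poly n := fg.1 - MvPolynomial.X prec * fg.2

/-- Completeness of the test: strict inequalities at `y` are detected at all sufficiently precise
approximations, whatever correction polynomials are used. -/
theorem exists_forall_aeval_diminish_pos (fs : List (Poly n × Poly n)) (y : CertVar n → ℝ)
    (h : ∀ fg ∈ fs, 0 < MvPolynomial.aeval y fg.1) : ∃ ε > 0, ∀ y' : CertVar n → ℝ,
      0 ≤ y' prec → y' prec ≤ ε → (∀ s, |y s - y' s| ≤ y' prec) →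
        ∀ fg ∈ fs, 0 < MvPolynomial.aeval y' (diminish fg) := by
  induction fs with
  | nil => exact ⟨1, one_pos, by simp⟩
  | cons fg fs ih =>
    obtain ⟨ε, hε, H⟩ := ih fun f hf => h f (List.mem_cons_of_mem _ hf)
    obtain ⟨ε', hε', H'⟩ := MvPolynomial.exists_forall_lt_aeval fg.1 fg.2 y
      (h fg List.mem_cons_self)
    refine ⟨min ε ε', lt_min hε hε', fun y' h0 h1 hy => List.forall_mem_cons.2
      ⟨?_, H y' h0 (h1.trans (min_le_left _ _)) hy⟩⟩
    have := H' y' _ h0 (h1.trans (min_le_right _ _)) hy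
    simpa [diminish] using this

/-- Soundness of the test: the subtracted term bounds the possible variation of `f` between `y'` and
`y`. -/
theorem aeval_pos_of_diminish {f : Poly n} {y y' : CertVar n → ℝ} (h1 : y' prec ≤ 1)
    (hy : ∀ s, |y s - y' s| ≤ y' prec) (h : 0 < MvPolynomial.aeval y' (diminish (f, f.lip))) :
    0 < MvPolynomial.aeval y f := by
  have := abs_le.1 (f.abs_aeval_sub_le h1 hy)
  simp only [diminish, map_sub, map_mul, MvPolynomial.aeval_X] at h
  linarith

/-- A polynomial together with its Lipschitz bound. -/
noncomputable def withLip (f : Poly n) : Poly n × Poly n := (f, f.lip)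

/-- Conditions under which the approximate image of the point is close to the projection. -/
noncomputable def pointConditions (n : ℕ) : List (Poly n × Poly n) :=
  (certificate MvPolynomial.X).map withLip ++
    withLip (MvPolynomial.X tol ^ 2 - 4 * (MvPolynomial.X err ^ 2 * pointSq MvPolynomial.X)) ::
    (List.finRange n).map fun i => (MvPolynomial.X tol, 2 * (approxPoint MvPolynomial.X i).lip)

/-- Conditions under which the point is outside of the stable subspace. -/
noncomputable def ballConditions (n : ℕ) : List (Poly n × Poly n) :=
  (certificate MvPolynomial.X).map withLip ++
    [withLip (defect MvPolynomial.X - MvPolynomial.X err ^ 2 * pointSq MvPolynomial.X)]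

theorem abs_sub_mulVec_le {M : Matrix (Fin n) (Fin n) ℝ} {y : CertVar n → ℝ}
    (hM : sumSq (approxProj y - M) ≤ y err ^ 2) :
    ∑ i, (approxPoint y i - M.mulVec (fun j => y (point j)) i) ^ 2 ≤ y err ^ 2 * pointSq y := by
  have h := sumSq_mulVec_le (approxProj y - M) (fun j => y (point j))
  rw [Matrix.sub_mulVec] at h
  exact h.trans (mul_le_mul_of_nonneg_right hM (Finset.sum_nonneg fun i _ => sq_nonneg _))

/-- The conditions at approximate values imply the certificate at exact values. -/
theorem certificate_pos_of_diminish {y y' : CertVar n → ℝ} (h1 : y' prec ≤ 1)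
    (hy : ∀ s, |y s - y' s| ≤ y' prec) {fs : List (Poly n × Poly n)}
    (h : ∀ fg ∈ (certificate MvPolynomial.X).map withLip ++ fs,
      0 < MvPolynomial.aeval y' (diminish fg)) : ∀ t ∈ certificate y, 0 < t := by
  rw [← aeval_certificate]
  intro t ht
  obtain ⟨f, hf, rfl⟩ := List.mem_map.1 ht
  exact aeval_pos_of_diminish h1 hy
    (h _ (List.mem_append_left _ (List.mem_map_of_mem hf)))

/-- The point conditions guarantee the tolerance. -/
theorem abs_approxPoint_sub_le {A : Matrix (Fin n) (Fin n) ℝ} (S : SpectralSplitting A)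
    {y y' : CertVar n → ℝ} (hA : toMatrix y = A) (h1 : y' prec ≤ 1)
    (hy : ∀ s, |y s - y' s| ≤ y' prec) (htol : y tol = y' tol) (ht0 : 0 < y tol)
    (h : ∀ fg ∈ pointConditions n, 0 < MvPolynomial.aeval y' (diminish fg)) (i : Fin n) :
    |approxPoint y' i - S.proj.mulVec (fun j => y (point j)) i| ≤ y tol := by
  have hE := (sumSq_approxProj_sub_proj_lt S hA (certificate_pos_of_diminish h1 hy h)).le
  have h2 := aeval_pos_of_diminish h1 hy (h _ (List.mem_append_right _ List.mem_cons_self))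
  have h3 := h _ (List.mem_append_right _ (List.mem_cons_of_mem _
    (List.mem_map_of_mem (List.mem_finRange i))))
  have h4 := (MvPolynomial.abs_aeval_sub_le (approxPoint (MvPolynomial.X : _ → Poly n) i) h1 hy)
  simp only [map_sub, map_mul, map_pow, MvPolynomial.aeval_X, aeval_pointSq, map_ofNat,
    diminish, aeval_approxPoint] at h2 h3 h4
  have h5 := abs_sub_mulVec_le hE
  have h6 := Finset.single_le_sum (f := fun i =>
    (approxPoint y i - S.proj.mulVec (fun j => y (point j)) i) ^ 2)
    (fun i _ => sq_nonneg _) (Finset.mem_univ i)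
  -- Half of the tolerance pays for the distance of `approxProj y` from the projection, by `h2`; the
  -- other half pays for the passage from `y` to `y'`, by `h3` and `h4`.
  have h7 : |approxPoint y i - S.proj.mulVec (fun j => y (point j)) i| ≤ y tol / 2 := by
    refine abs_le_of_sq_le_sq ?_ (by linarith)
    have := h6.trans h5
    nlinarith
  rw [abs_le] at h4 h7 ⊢
  constructor <;> linarith [h4.1, h4.2, h7.1, h7.2]

/-- If the projection `P` fixed the point `x`, then `(1 - E) x = (P - E) x` would have norm at most
`err * ‖x‖`, below what the last condition asserts. -/
theorem mulVec_ne_of_ballConditions {A : Matrix (Fin n) (Fin n) ℝ} (S : SpectralSplitting A)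
    {y y' : CertVar n → ℝ} (hA : toMatrix y = A) (h1 : y' prec ≤ 1)
    (hy : ∀ s, |y s - y' s| ≤ y' prec)
    (h : ∀ fg ∈ ballConditions n, 0 < MvPolynomial.aeval y' (diminish fg)) :
    S.proj.mulVec (fun j => y (point j)) ≠ fun j => y (point j) := by
  intro hP
  have hE := (sumSq_approxProj_sub_proj_lt S hA (certificate_pos_of_diminish h1 hy h)).le
  have h2 := aeval_pos_of_diminish h1 hy (h _ (List.mem_append_right _ List.mem_cons_self))
  simp only [map_sub, map_mul, map_pow, MvPolynomial.aeval_X, aeval_pointSq, aeval_defect] at h2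
  have h5 := abs_sub_mulVec_le hE
  have h6 : defect y = ∑ i, (approxPoint y i - S.proj.mulVec (fun j => y (point j)) i) ^ 2 := by
    refine Finset.sum_congr rfl fun i _ => ?_
    rw [hP, Matrix.sub_mulVec, Matrix.one_mulVec, Pi.sub_apply, ← neg_sub, neg_sq]
    rfl
  linarith

end CertVar

/-! ### Existence of rational certificates and correctness of accepted ones -/

namespace CertVar

variable {n : ℕ}

theorem exists_abs_sub_ratOfCode_lt (r : ℝ) {ε : ℝ} (hε : 0 < ε) :
    ∃ c : ℕ, |r - ratOfCode c| < ε := by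
  obtain ⟨q, hq⟩ := exists_rat_near r hε
  obtain ⟨c, rfl⟩ := ratOfCode_surjective q
  exact ⟨c, hq⟩

/-- Certificates can be found with rational data, for all sufficiently precise approximations. -/
theorem exists_list_forall_diminish_pos (fs : List (Poly n × Poly n)) (y : CertVar n → ℝ)
    (hprec : y prec = 0) (h : ∀ fg ∈ fs, 0 < MvPolynomial.aeval y fg.1) :
    ∃ w N : ℕ, (∀ s, (∀ i j, s ≠ entry i j) →
        |y s - ratOfCode (listEntry (index s) w)| < 1 / 2 ^ N / (n + 1)) ∧
      ∀ y' : CertVar n → ℝ, y' prec = 1 / 2 ^ N → (∀ s, s ≠ prec → |y s - y' s| ≤ 1 / 2 ^ N) →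
        ∀ fg ∈ fs, 0 < MvPolynomial.aeval y' (diminish fg) := by
  obtain ⟨ε, hε, H⟩ := exists_forall_aeval_diminish_pos fs y h
  obtain ⟨N, hN⟩ := exists_pow_lt_of_lt_one hε (show (1 / 2 : ℝ) < 1 by norm_num)
  rw [one_div_pow] at hN
  -- The extra factor `n + 1` makes coordinatewise closeness imply Euclidean distance less than `2 ^
  -- (-N)`, as needed when the point is to lie in a listed ball.
  choose c hc using fun s => exists_abs_sub_ratOfCode_lt (y s)
    (show (0 : ℝ) < 1 / 2 ^ N / (n + 1) by positivity)
  obtain ⟨w, hw⟩ := exists_listEntry_index_eq c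
  refine ⟨w, N, fun s hs => by rw [hw s hs]; exact hc s, fun y' hp hy => ?_⟩
  refine H y' (by rw [hp]; positivity) (by rw [hp]; exact hN.le) fun s => ?_
  rw [hp]
  by_cases hs : s = prec
  · rw [hs, hprec, hp, zero_sub, abs_neg, abs_of_nonneg (by positivity)]
  · exact hy s hs

theorem div_add_one_le (N n : ℕ) : (1 : ℝ) / 2 ^ N / (n + 1) ≤ 1 / 2 ^ N :=
  div_le_self (by positivity) (by linarith [(Nat.cast_nonneg n : (0 : ℝ) ≤ n)])

theorem value_prec (p : ℕ → ℕ) (w N : ℕ) : value (code (n := n) p w N) prec = 1 / 2 ^ N := by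
  simp [value, code, ratOfCode_codeTwoPow]

theorem value_pointCode_prec (p : ℕ → ℕ) (l t w N : ℕ) :
    value (pointCode (n := n) p l t w N) prec = 1 / 2 ^ N := by
  simp [value, pointCode, code, ratOfCode_codeTwoPow]

theorem value_pointCode_tol (p : ℕ → ℕ) (l t w N : ℕ) :
    value (pointCode (n := n) p l t w N) tol = 1 / 2 ^ t := by
  simp [value, pointCode, ratOfCode_codeTwoPow]

theorem one_div_two_pow_le_one (N : ℕ) : (1 : ℝ) / 2 ^ N ≤ 1 :=
  div_le_one_of_le₀ (one_le_pow₀ one_le_two) (by positivity)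

theorem abs_entry_sub_le {p : ℕ → ℕ} {A : Matrix (Fin n) (Fin n) ℝ} (hp : IsMatrixName p A)
    (i j : Fin n) (N : ℕ) :
    |A i j - ratOfCode (p (Nat.pair i (Nat.pair j N)))| ≤ 1 / 2 ^ N := by
  rw [abs_sub_comm]
  exact hp i j N

/-- The rational point with code `l`. -/
noncomputable def ratPoint (n l : ℕ) (i : Fin n) : ℝ := ratOfCode (listEntry i l)

/-- The search terminates for every rational point, every tolerance and every name of the matrix. -/
theorem exists_pointConditions {p : ℕ → ℕ} {A : Matrix (Fin n) (Fin n) ℝ}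
    (S : SpectralSplitting A) (hp : IsMatrixName p A) (l t : ℕ) :
    ∃ w N, ∀ fg ∈ pointConditions n,
      0 < MvPolynomial.aeval (value (pointCode p l t w N)) (diminish fg) := by
  set Q : ℝ := ∑ i, ratPoint n l i ^ 2
  have hQ : 0 ≤ Q := Finset.sum_nonneg fun i _ => sq_nonneg _
  obtain ⟨δ, h0, h1, hδ⟩ : ∃ δ : ℝ, 0 < δ ∧ δ < 1 / 4 ∧ 4 * (δ ^ 2 * Q) < (1 / 2 ^ t) ^ 2 := by
    have hc : Filter.Tendsto (fun δ : ℝ => 4 * (δ ^ 2 * Q)) (nhdsWithin 0 (Set.Ioi 0)) (nhds 0) := by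
      have : Continuous fun δ : ℝ => 4 * (δ ^ 2 * Q) := by fun_prop
      simpa using (this.tendsto 0).mono_left nhdsWithin_le_nhds
    have e1 := hc.eventually (gt_mem_nhds (show (0 : ℝ) < (1 / 2 ^ t) ^ 2 by positivity))
    have e2 : ∀ᶠ δ in nhdsWithin (0 : ℝ) (Set.Ioi 0), δ ∈ Set.Ioo (0 : ℝ) (1 / 4) :=
      Ioo_mem_nhdsGT (by norm_num)
    obtain ⟨δ, h, h'⟩ := (e1.and e2).exists
    exact ⟨δ, h'.1, h'.2, h⟩
  obtain ⟨y, hA, hx, herr, htol, hprec, -, hcert⟩ :=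
    exists_certificate S (ratPoint n l) h0 h1 (1 / 2 ^ t)
  have hy : ∀ fg ∈ pointConditions n, 0 < MvPolynomial.aeval y fg.1 := by
    intro fg hfg
    rw [← aeval_certificate] at hcert
    simp only [pointConditions, List.mem_append, List.mem_cons, List.mem_map] at hfg
    rcases hfg with ⟨f, hf, rfl⟩ | rfl | ⟨i, -, rfl⟩
    · exact hcert _ (List.mem_map_of_mem hf)
    · simp only [withLip, map_sub, map_mul, map_pow, MvPolynomial.aeval_X, aeval_pointSq,
        map_ofNat, htol, herr]
      rw [show pointSq y = Q by simp [pointSq, hx, Q]]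
      exact sub_pos.2 hδ
    · simp only [MvPolynomial.aeval_X, htol]
      positivity
  obtain ⟨w, N, hw, H⟩ := exists_list_forall_diminish_pos _ y hprec hy
  refine ⟨w, N, H _ (value_pointCode_prec ..) fun s hs => ?_⟩
  have hpos : (0 : ℝ) ≤ 1 / 2 ^ N := by positivity
  cases s with
  | prec => exact absurd rfl hs
  | entry i j =>
    have h := abs_entry_sub_le hp i j N
    rw [← hA] at h
    exact h
  | point i =>
    rw [hx, show value (pointCode p l t w N) (point i) = ratPoint n l i from rfl, sub_self, abs_zero]
    exact hpos
  | tol =>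
    rw [htol, value_pointCode_tol, sub_self, abs_zero]
    exact hpos
  | _ => exact (hw _ (by simp)).le.trans (div_add_one_le N n)

/-- The rational centre listed in `w`. -/
noncomputable def ratCentre (n w : ℕ) : EuclideanSpace ℝ (Fin n) :=
  WithLp.toLp 2 fun j => (ratOfCode (listEntry (Nat.pair 3 j) w) : ℝ)

/-- The accepted balls cover the complement: a point moved by the projection has an exact
certificate, and its rational perturbation provides the centre. -/
theorem exists_ballConditions {p : ℕ → ℕ} {A : Matrix (Fin n) (Fin n) ℝ}
    (S : SpectralSplitting A) (hp : IsMatrixName p A) {x : EuclideanSpace ℝ (Fin n)}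
    (hx : S.proj.mulVec x.ofLp ≠ x.ofLp) :
    ∃ w N, (∀ fg ∈ ballConditions n,
      0 < MvPolynomial.aeval (value (code p w N)) (diminish fg)) ∧
      x ∈ Metric.ball (ratCentre n w) (1 / 2 ^ N) := by
  set Q : ℝ := ∑ i, x i ^ 2
  set D : ℝ := ∑ i, ((1 - S.proj).mulVec x.ofLp i) ^ 2 with hD
  have hD0 : 0 < D := by
    obtain ⟨i, hi⟩ := Function.ne_iff.1 hx
    refine Finset.sum_pos' (fun i _ => sq_nonneg _) ⟨i, Finset.mem_univ i, ?_⟩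
    rw [Matrix.sub_mulVec, Matrix.one_mulVec]
    have hne : (x.ofLp - S.proj.mulVec x.ofLp) i ≠ 0 := sub_ne_zero.2 (Ne.symm hi)
    positivity
  obtain ⟨δ, h0, h1, hδ⟩ : ∃ δ : ℝ, 0 < δ ∧ δ < 1 / 4 ∧ δ ^ 2 * Q < D := by
    have hc : Filter.Tendsto (fun δ : ℝ => δ ^ 2 * Q) (nhdsWithin 0 (Set.Ioi 0)) (nhds 0) := by
      have : Continuous fun δ : ℝ => δ ^ 2 * Q := by fun_prop
      simpa using (this.tendsto 0).mono_left nhdsWithin_le_nhds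
    have e1 := hc.eventually (gt_mem_nhds hD0)
    have e2 : ∀ᶠ δ in nhdsWithin (0 : ℝ) (Set.Ioi 0), δ ∈ Set.Ioo (0 : ℝ) (1 / 4) :=
      Ioo_mem_nhdsGT (by norm_num)
    obtain ⟨δ, h, h'⟩ := (e1.and e2).exists
    exact ⟨δ, h'.1, h'.2, h⟩
  obtain ⟨y, hA, hxy, herr, -, hprec, hP, hcert⟩ := exists_certificate S x.ofLp h0 h1 0
  have hy : ∀ fg ∈ ballConditions n, 0 < MvPolynomial.aeval y fg.1 := by
    intro fg hfg
    rw [← aeval_certificate] at hcert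
    simp only [ballConditions, List.mem_append, List.mem_map, List.mem_singleton] at hfg
    rcases hfg with ⟨f, hf, rfl⟩ | rfl
    · exact hcert _ (List.mem_map_of_mem hf)
    · simp only [withLip, map_sub, map_mul, map_pow, MvPolynomial.aeval_X, aeval_pointSq,
        aeval_defect, herr]
      rw [show pointSq y = Q by simp [pointSq, hxy, Q],
        show defect y = D by simp only [defect, hP, hxy, D]]
      exact sub_pos.2 hδ
  obtain ⟨w, N, hw, H⟩ := exists_list_forall_diminish_pos _ y hprec hy
  refine ⟨w, N, H _ (value_prec ..) fun s hs => ?_, ?_⟩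
  · cases s with
    | prec => exact absurd rfl hs
    | entry i j =>
      have h := abs_entry_sub_le hp i j N
      rw [← hA] at h
      exact h
    | _ => exact (hw _ (by simp)).le.trans (div_add_one_le N n)
  · rw [Metric.mem_ball, EuclideanSpace.dist_eq, Real.sqrt_lt' (by positivity)]
    have hn : (0 : ℝ) < n + 1 := by positivity
    have hle : ∀ i : Fin n, dist (x i) (ratCentre n w i) ^ 2 ≤ (1 / 2 ^ N / (n + 1)) ^ 2 :=
      fun i => by
        refine pow_le_pow_left₀ dist_nonneg ?_ 2
        have := hw (point i) (by simp)
        rw [hxy] at this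
        exact this.le
    refine (Finset.sum_le_sum fun i _ => hle i).trans_lt ?_
    rw [Finset.sum_const, Finset.card_univ, Fintype.card_fin, nsmul_eq_mul, div_pow]
    have h2 : (0 : ℝ) < (1 / 2 ^ N) ^ 2 := by positivity
    rw [mul_div_assoc', div_lt_iff₀ (by positivity), mul_comm]
    refine mul_lt_mul_of_pos_left ?_ h2
    nlinarith [(Nat.cast_nonneg n : (0 : ℝ) ≤ n)]

/-- The exact values corresponding to approximate ones. -/
def exactValue (A : Matrix (Fin n) (Fin n) ℝ) (x : Fin n → ℝ) (y : CertVar n → ℝ) : CertVar n → ℝ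
  | entry i j => A i j
  | point i => x i
  | s => y s

/-- The point is one more quantity known up to `2 ^ (-N)`, so a single successful test excludes all
points of the ball at once. -/
theorem ne_of_ballConditions {p : ℕ → ℕ} {A : Matrix (Fin n) (Fin n) ℝ}
    (S : SpectralSplitting A) (hp : IsMatrixName p A) {w N : ℕ} {x : EuclideanSpace ℝ (Fin n)}
    (hx : x ∈ Metric.ball (ratCentre n w) (1 / 2 ^ N))
    (h : ∀ fg ∈ ballConditions n, 0 < MvPolynomial.aeval (value (code p w N)) (diminish fg)) :
    S.proj.mulVec x.ofLp ≠ x.ofLp := by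
  refine mulVec_ne_of_ballConditions S (y := exactValue A x.ofLp (value (code p w N))) rfl
    (by rw [value_prec]; exact one_div_two_pow_le_one N) (fun s => ?_) h
  rw [value_prec]
  cases s with
  | entry i j => exact abs_entry_sub_le hp i j N
  | point i =>
    have h1 : ‖(x - ratCentre n w) i‖ ≤ ‖x - ratCentre n w‖ := PiLp.norm_apply_le _ i
    rw [← dist_eq_norm x] at h1
    exact h1.trans (le_of_lt hx)
  | _ => simp [exactValue]

/-- The target does not depend on `w` and `N`; so outputs obtained from different certificates
approximate the same point. -/
theorem abs_approxPoint_value_sub_le {p : ℕ → ℕ} {A : Matrix (Fin n) (Fin n) ℝ}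
    (S : SpectralSplitting A) (hp : IsMatrixName p A) {l t w N : ℕ}
    (h : ∀ fg ∈ pointConditions n,
      0 < MvPolynomial.aeval (value (pointCode p l t w N)) (diminish fg)) (i : Fin n) :
    |approxPoint (value (pointCode p l t w N)) i - S.proj.mulVec (ratPoint n l) i| ≤ 1 / 2 ^ t := by
  have htol : exactValue A (ratPoint n l) (value (pointCode p l t w N)) tol = 1 / 2 ^ t :=
    value_pointCode_tol ..
  have := abs_approxPoint_sub_le S (y := exactValue A (ratPoint n l) (value (pointCode p l t w N)))
    (y' := value (pointCode p l t w N)) rfl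
    (by rw [value_pointCode_prec]; exact one_div_two_pow_le_one N) (fun s => ?_) rfl
    (by rw [htol]; positivity) h i
  · rw [htol] at this
    exact this
  rw [value_pointCode_prec]
  cases s with
  | entry i j => exact abs_entry_sub_le hp i j N
  | point i =>
    rw [show value (pointCode p l t w N) (point i) = ratPoint n l i from rfl]
    simp [exactValue]
  | _ => simp [exactValue]

/-! ### The program -/

theorem oracleComputable_code (s : CertVar n) :
    OracleComputable fun p (x : ℕ) => code p x.unpair.1 x.unpair.2 s := by
  have hl : ∀ s : CertVar n, OracleComputable fun _ (x : ℕ) => listEntry (index s) x.unpair.1 :=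
    fun s => (primrec_listEntry.comp (.const _) primrec_unpair_fst).oracleComputable
  cases s with
  | entry i j =>
    exact OracleComputable.query.comp (Primrec.oracleComputable (Primrec₂.natPair.comp (.const _)
      (Primrec₂.natPair.comp (.const _) primrec_unpair_snd)))
  | prec => exact (primrec_codeTwoPow.comp primrec_unpair_snd).oracleComputable
  | _ => exact hl _

/-- The index of the rational point whose projection is requested by the output position `m`. -/
def pointIndex (m : ℕ) : ℕ := m.div2.unpair.1

/-- The tolerance requested by the output position `m` is `2 ^ (-tolIndex m)`. -/
def tolIndex (m : ℕ) : ℕ := (m.div2.unpair.2 - 1).unpair.2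

/-- The coordinate requested by the output position `m`. -/
def coordIndex (m : ℕ) : ℕ := (m.div2.unpair.2 - 1).unpair.1

theorem primrec_pointIndex : Primrec pointIndex := primrec_unpair_fst.comp .nat_div2

theorem primrec_tolIndex : Primrec tolIndex :=
  primrec_unpair_snd.comp (Primrec.nat_sub.comp (primrec_unpair_snd.comp .nat_div2) (.const 1))

theorem primrec_coordIndex : Primrec coordIndex :=
  primrec_unpair_fst.comp (Primrec.nat_sub.comp (primrec_unpair_snd.comp .nat_div2) (.const 1))

/-- The codes used for the output position `x.1` in the step `x.2` of the search. -/
def stepCode (p : ℕ → ℕ) (x : ℕ × ℕ) : CertVar n → ℕ :=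
  pointCode p (pointIndex x.1) (tolIndex x.1) x.2.unpair.1 x.2.unpair.2

theorem oracleComputable_stepCode (s : CertVar n) :
    OracleComputable fun p x => stepCode p x s := by
  have hc : OracleComputable fun p (x : ℕ × ℕ) => code p x.2.unpair.1 x.2.unpair.2 s :=
    (oracleComputable_code s).comp Primrec.snd.oracleComputable
  cases s with
  | point i =>
    exact (primrec_listEntry.comp (.const _) (primrec_pointIndex.comp .fst)).oracleComputable
  | tol => exact (primrec_codeTwoPow.comp (primrec_tolIndex.comp .fst)).oracleComputable
  | _ => exact hc

theorem exists_test {α : Type*} [Primcodable α] {u : CertVar n → (ℕ → ℕ) → α → ℕ}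
    (hu : ∀ s, OracleComputable (u s)) (fs : List (Poly n × Poly n)) :
    ∃ t : (ℕ → ℕ) → α → Bool, OracleComputable t ∧ ∀ p a, t p a = true ↔
      ∀ fg ∈ fs, 0 < MvPolynomial.aeval (value fun s => u s p a) (diminish fg) := by
  obtain ⟨t, ht, ht'⟩ := OracleComputable.exists_decide_eval_pos hu (fs.map diminish)
  refine ⟨t, ht, fun p a => ?_⟩
  rw [ht', List.forall_mem_map]
  refine forall₂_congr fun fg _ => ?_
  rw [← cast_eval, Rat.cast_pos]

theorem exists_pointOutput (n : ℕ) : ∃ g : (ℕ → ℕ) → ℕ × ℕ → ℕ, OracleComputable g ∧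
    ∀ p x (i : Fin n), coordIndex x.1 = i →
      (ratOfCode (g p x) : ℝ) = approxPoint (value (stepCode p x)) i := by
  choose o ho ho' using fun i => OracleComputable.exists_ratOfCode_eq_aeval
    (oracleComputable_stepCode (n := n)) (approxPoint MvPolynomial.X i)
  -- Positions that ask for a coordinate beyond `n` receive the default `0`.
  refine ⟨fun p x => (List.ofFn fun i => o i p x).getD (coordIndex x.1) 0,
    .comp₂ (h := fun (l : List ℕ) k => l.getD k 0) (Primrec.list_getD 0) (.list_ofFn ho)
      (primrec_coordIndex.comp .fst).oracleComputable, fun p x i hi => ?_⟩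
  simp only [hi]
  rw [← aeval_approxPoint, ← cast_eval, ← ho']
  simp [List.getD]

/-- No search is needed here: every pair `(w, N)` contributes a ball, which gets radius zero if the
test fails. The tag `3` is the one that `index` gives to `point`. -/
theorem exists_ballOutput (n : ℕ) : ∃ g : (ℕ → ℕ) → ℕ → ℕ, OracleComputable g ∧
    ∀ p w N,
      ((∀ fg ∈ ballConditions n, 0 < MvPolynomial.aeval (value (code p w N)) (diminish fg)) →
        (ratOfCode (g p (2 * Nat.pair (Nat.pair w N) 0 + 1)) : ℝ) = 1 / 2 ^ N ∧
        ∀ j, g p (2 * Nat.pair (Nat.pair w N) (j + 1) + 1) = listEntry (Nat.pair 3 j) w) ∧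
      ((¬ ∀ fg ∈ ballConditions n, 0 < MvPolynomial.aeval (value (code p w N)) (diminish fg)) →
        (ratOfCode (g p (2 * Nat.pair (Nat.pair w N) 0 + 1)) : ℝ) = 0) := by
  obtain ⟨t, ht, ht'⟩ := exists_test (oracleComputable_code (n := n)) (ballConditions n)
  have hM : Primrec fun m : ℕ => m.div2.unpair.1 := primrec_unpair_fst.comp .nat_div2
  have hr : Primrec fun m : ℕ => m.div2.unpair.2 := primrec_unpair_snd.comp .nat_div2
  refine ⟨fun p m => bif t p m.div2.unpair.1 then
    (bif decide (m.div2.unpair.2 = 0) then codeTwoPow m.div2.unpair.1.unpair.2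
      else listEntry (Nat.pair 3 (m.div2.unpair.2 - 1)) m.div2.unpair.1.unpair.1) else 0,
    .cond (ht.comp hM.oracleComputable) (.cond (PrimrecPred.decide (Primrec.eq.comp hr
      (.const 0))).oracleComputable (primrec_codeTwoPow.comp (primrec_unpair_snd.comp
        hM)).oracleComputable (primrec_listEntry.comp (Primrec₂.natPair.comp (.const 3)
          (Primrec.nat_sub.comp hr (.const 1))) (primrec_unpair_fst.comp hM)).oracleComputable)
      (.const 0), fun p w N => ?_⟩
  have hdiv : ∀ k : ℕ, (2 * k + 1).div2 = k := fun k => by rw [Nat.div2_val]; omega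
  have h := ht' p (Nat.pair w N)
  simp only [Nat.unpair_pair] at h
  refine ⟨fun hc => ?_, fun hc => ?_⟩
  · have hb := h.2 hc
    simp [hb, ratOfCode_codeTwoPow]
  · have hb : t p (Nat.pair w N) = false := by
      rw [← Bool.not_eq_true]
      exact fun hb => hc (h.1 hb)
    simp [hb, ratOfCode_zero]

end CertVar

/-! ### The machine for the stable subspace -/

open CertVar

/-- The stable subspace is the range of the stable projection. -/
theorem mem_stableSubspace_iff {n : ℕ} {A : Matrix (Fin n) (Fin n) ℝ} (S : SpectralSplitting A)
    (x : EuclideanSpace ℝ (Fin n)) :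
    x ∈ (stableSubspace A : Set (EuclideanSpace ℝ (Fin n))) ↔
      S.proj.mulVec x.ofLp = x.ofLp := S.mem_spectralSubspace_iff x

theorem denseRange_ratPoint (n : ℕ) : DenseRange (ratPoint n) := by
  rw [Metric.denseRange_iff]
  intro x r hr
  choose c hc using fun i => exists_abs_sub_ratOfCode_lt (x i) hr
  obtain ⟨l, hl⟩ := exists_listEntry_eq n fun k => if h : k < n then c ⟨k, h⟩ else 0
  refine ⟨l, (dist_pi_lt_iff hr).2 fun i => ?_⟩
  have := hl i i.2
  simp only [i.2, dite_true] at this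
  rw [ratPoint, this]
  exact hc i

/-- The images of the rational points under the projection are dense in the stable subspace. -/
theorem closure_range_proj {n : ℕ} {A : Matrix (Fin n) (Fin n) ℝ} (S : SpectralSplitting A) :
    closure (Set.range fun l => (WithLp.toLp 2 (S.proj.mulVec (ratPoint n l)) :
      EuclideanSpace ℝ (Fin n))) = stableSubspace A := by
  have hf : Continuous fun x : Fin n → ℝ =>
      (WithLp.toLp 2 (S.proj.mulVec x) : EuclideanSpace ℝ (Fin n)) :=
    (PiLp.continuous_toLp 2 _).comp (Continuous.matrix_mulVec continuous_const continuous_id)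
  refine subset_antisymm (closure_minimal ?_ (stableSubspace A).isClosed) fun x hx => ?_
  · rintro _ ⟨l, rfl⟩
    rw [mem_stableSubspace_iff S, Matrix.mulVec_mulVec, S.proj_mul_proj]
  · rw [mem_stableSubspace_iff S] at hx
    have h1 := hf.range_subset_closure_image_dense (denseRange_ratPoint n)
    rw [← Set.range_comp] at h1
    exact h1 ⟨x.ofLp, by simp only [hx]⟩

theorem isComputableMap_stableSubspace (n : ℕ) :
    IsComputableMap
      (fun p (A : {A : Matrix (Fin n) (Fin n) ℝ // IsHyperbolicMatrix A}) => IsMatrixName p A.1)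
      IsClosedName (fun A => stableSubspace A.1) := by
  obtain ⟨t, ht, ht'⟩ := exists_test (oracleComputable_stepCode (n := n)) (pointConditions n)
  obtain ⟨o, ho, ho'⟩ := exists_pointOutput n
  obtain ⟨g, hg, hg'⟩ := exists_ballOutput n
  have hodd : Primrec fun x : ℕ × ℕ => x.1.bodd := Primrec.nat_bodd.comp .fst
  have hflag : Primrec fun x : ℕ × ℕ => decide (x.1.div2.unpair.2 = 0) :=
    PrimrecPred.decide (Primrec.eq.comp (primrec_unpair_snd.comp (Primrec.nat_div2.comp .fst))
      (.const 0))
  -- Odd positions describe balls and even positions `2 * ⟨l, 0⟩` are flags; both pass the test at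
  -- once. Only the positions of point coordinates need a certificate.
  obtain ⟨c, hc⟩ := OracleComputable.exists_run_search
    (t := fun p x => x.1.bodd || (decide (x.1.div2.unpair.2 = 0) || t p x))
    (g := fun p x => bif x.1.bodd then g p x.1 else
      bif decide (x.1.div2.unpair.2 = 0) then 1 else o p x)
    (.comp₂ Primrec.or hodd.oracleComputable (.comp₂ Primrec.or hflag.oracleComputable ht))
    (.cond hodd.oracleComputable (hg.comp Primrec.fst.oracleComputable)
      (.cond hflag.oracleComputable (.const 1) ho))
  refine ⟨c, fun ⟨A, hA⟩ p hp => ?_⟩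
  obtain ⟨S⟩ := SpectralSplitting.nonempty_of_hyperbolic hA
  have hex : ∀ m, ∃ s, (m.bodd || (decide (m.div2.unpair.2 = 0) || t p (m, s))) = true := by
    intro m
    obtain ⟨w, N, h⟩ := exists_pointConditions S hp (pointIndex m) (tolIndex m)
    refine ⟨Nat.pair w N, ?_⟩
    have : t p (m, Nat.pair w N) = true := (ht' _ _).2 (by simpa [stepCode] using h)
    simp [this]
  choose s hs hq using fun m => hc p m (hex m)
  refine ⟨_, hq, ⟨fun l => WithLp.toLp 2 (S.proj.mulVec (ratPoint n l)), ?_, ?_⟩, ?_⟩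
  · intro l _ j k
    have hm : (2 * Nat.pair l (Nat.pair j k + 1)).div2 = Nat.pair l (Nat.pair j k + 1) := by
      rw [Nat.div2_val]; omega
    have hb : (2 * Nat.pair l (Nat.pair j k + 1)).bodd = false := by simp
    have h := hs (2 * Nat.pair l (Nat.pair j k + 1))
    simp only [hb, hm, Nat.unpair_pair, Nat.succ_ne_zero, decide_false, Bool.false_or] at h ⊢
    rw [ht'] at h
    simp only [cond_false]
    rw [ho' p _ j (by simp only [coordIndex, hm, Nat.unpair_pair, Nat.add_sub_cancel])]
    have h' := abs_approxPoint_value_sub_le S hp h j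
    simp only [pointIndex, tolIndex, hm, Nat.unpair_pair, Nat.add_sub_cancel] at h'
    simpa only [stepCode, pointIndex, tolIndex, hm, Nat.unpair_pair, Nat.add_sub_cancel] using h'
  -- All flags equal `1`, so no index is skipped.
  · rw [← closure_range_proj S]
    congr 1
    ext x
    simp [Nat.div2_val]
  · ext x
    rw [Set.mem_compl_iff, mem_stableSubspace_iff S, Set.mem_iUnion]
    have hb : ∀ k, (2 * k + 1).bodd = true := fun k => by simp
    simp only [hb, cond_true]
    constructor
    · intro hx
      obtain ⟨w, N, h, hball⟩ := exists_ballConditions S hp hx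
      refine ⟨Nat.pair w N, ?_⟩
      obtain ⟨h1, h2⟩ := (hg' p w N).1 h
      simp only [h1, h2]
      exact hball
    · rintro ⟨M, hM⟩
      obtain ⟨w, N, rfl⟩ : ∃ w N, M = Nat.pair w N := ⟨_, _, (Nat.pair_unpair M).symm⟩
      by_cases h : ∀ fg ∈ ballConditions n,
          0 < MvPolynomial.aeval (value (code p w N)) (diminish fg)
      · obtain ⟨h1, h2⟩ := (hg' p w N).1 h
        simp only [h1, h2] at hM
        exact ne_of_ballConditions S hp hM h
      · rw [(hg' p w N).2 h, Metric.ball_zero] at hM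
        exact hM.elim

/-! ### The unstable subspace -/

theorem complexEnd_neg {n : ℕ} (A : Matrix (Fin n) (Fin n) ℝ) :
    complexEnd (-A) = -complexEnd A := by
  have : (-A).map (fun a : ℝ => (a : ℂ)) = -A.map fun a : ℝ => (a : ℂ) := by
    ext i j
    simp
  rw [complexEnd, complexEnd, this, map_neg]

theorem maxGenEigenspace_complexEnd_neg {n : ℕ} (A : Matrix (Fin n) (Fin n) ℝ) (z : ℂ) :
    (complexEnd (-A)).maxGenEigenspace z = (complexEnd A).maxGenEigenspace (-z) := by
  ext w
  rw [Module.End.mem_maxGenEigenspace, Module.End.mem_maxGenEigenspace]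
  refine exists_congr fun k => ?_
  have h : complexEnd (-A) - z • 1 = -(complexEnd A - (-z) • 1) := by
    rw [complexEnd_neg]
    exact LinearMap.ext fun v => by simp; abel
  rw [h]
  rcases Nat.even_or_odd k with hk | hk
  · have := Even.neg_pow hk (complexEnd A - (-z) • 1)
    exact iff_of_eq (congrArg (· = 0) (congrArg (fun f : Module.End ℂ (Fin n → ℂ) => f w) this))
  · have := Odd.neg_pow hk (complexEnd A - (-z) • 1)
    refine (iff_of_eq (congrArg (· = 0)
      (congrArg (fun f : Module.End ℂ (Fin n → ℂ) => f w) this))).trans ?_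
    exact neg_eq_zero

theorem IsHyperbolicMatrix.neg {n : ℕ} {A : Matrix (Fin n) (Fin n) ℝ}
    (hA : IsHyperbolicMatrix A) : IsHyperbolicMatrix (-A) := by
  intro z hz h0
  obtain ⟨w, hw⟩ := hz.exists_hasEigenvector
  have h := hw.apply_eq_smul
  rw [complexEnd_neg, LinearMap.neg_apply, neg_eq_iff_eq_neg, ← neg_smul] at h
  exact hA (-z) (Module.End.hasEigenvalue_of_hasEigenvector
    ⟨Module.End.mem_eigenspace_iff.2 h, hw.2⟩) (by simp [h0])

theorem stableSubspace_neg {n : ℕ} (A : Matrix (Fin n) (Fin n) ℝ) :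
    stableSubspace (-A) = unstableSubspace A := by
  have : spectralSubspace (-A) {z | z.re < 0} = spectralSubspace A {z | 0 < z.re} := by
    rw [spectralSubspace, spectralSubspace]
    congr 1
    ext v
    simp only [Set.mem_ofPred_eq, maxGenEigenspace_complexEnd_neg]
    constructor
    · rintro ⟨z, hz, h⟩
      exact ⟨-z, by simpa using hz, h⟩
    · rintro ⟨z, hz, h⟩
      exact ⟨-z, by simpa using hz, by simpa using h⟩
  simp only [stableSubspace, unstableSubspace, this]

theorem IsMatrixName.neg {n : ℕ} {p : ℕ → ℕ} {A : Matrix (Fin n) (Fin n) ℝ}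
    (hp : IsMatrixName p A) : IsMatrixName (fun m => codeOpp (p m)) (-A) := by
  intro i j k
  have := hp i j k
  rw [ratOfCode_codeOpp, Matrix.neg_apply, Rat.cast_neg, neg_sub_neg, abs_sub_comm]
  exact this

theorem mainTheorem3 (n : ℕ) :
    IsComputableMap
        (fun p (A : {A : Matrix (Fin n) (Fin n) ℝ // IsHyperbolicMatrix A}) =>
          IsMatrixName p A.1)
        IsClosedName (fun A => stableSubspace A.1) ∧
      IsComputableMap
        (fun p (A : {A : Matrix (Fin n) (Fin n) ℝ // IsHyperbolicMatrix A}) =>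
          IsMatrixName p A.1)
        IsClosedName (fun A => unstableSubspace A.1) := by
  refine ⟨isComputableMap_stableSubspace n, ?_⟩
  obtain ⟨c, hc⟩ := isComputableMap_stableSubspace n
  -- The unstable subspace of `A` is the stable subspace of `-A`, and negating every code read from
  -- a name of `A` gives a name of `-A`.
  obtain ⟨e, he⟩ := OracleComputable.comp₁ primrec_codeOpp OracleComputable.query
  refine ⟨OracleProgram.subst e c, fun A p hp => ?_⟩
  obtain ⟨q, hq, hname⟩ := hc ⟨-A.1, A.2.neg⟩ _ hp.neg
  refine ⟨q, fun m => ?_, ?_⟩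
  · rw [OracleProgram.run_subst (he p)]
    exact hq m
  · change IsClosedName q (unstableSubspace A.1)
    rw [← stableSubspace_neg]
    exact hname
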